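/- Let $T>0$, let $\Omega\subset\mathbb{R}^N$ be a bounded domain, $\Omega_T=(0,T)\times\Omega$. Let $k\in L_{1,loc}([0,\infty))$ be nonnegative and nonincreasing and let $l\in L_{1,loc}([0,\infty))$ satisfy $k\ast l=1$ on $(0,\infty)$. Here $(a\ast v)(t)=\int_0^t a(t-\tau)v(\tau)\,d\tau$ denotes convolution in time, and $(a\overset{T}{\ast}v)(t)=\int_t^T a(\tau-t)v(\tau)\,d\tau$ for $t\in(0,T)$. For $n\in\mathbb{N}$, $n\ge 1$, let $h_n\in L_{1,loc}([0,\infty))$ be the resolvent kernel of $n\,l$, i.e. $h_n+n\,(h_n\ast l)=n\,l$ on $(0,\infty)$, and put $k_n=k\ast h_n$. Let $u_0\in L_2(\Omega)$, $f\in L_2(\Omega_T)$, $u\in L_2(\Omega_T)$, and $k\ast u\in C([0,T];L_2(\Omega))$ with $(k\ast u)|_{t=0}=0$. Let $V=\mathring H^1_2(\Omega)$ (the closure of $C_0^\infty(\Omega)$ in $H^1_2(\Omega)$; Dirichlet case) or $V=H^1_2(\Omega)$ (Neumann case). Suppose that $w\in L_2((0,T);V)$, $w\ge 0$, and that for every $n\ge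 1$ and every $\psi\in V$ with $\psi\ge 0$, $$\int_\Omega\Big(\psi\,\partial_t\big(k_n\ast[u-u_0]\big)+(h_n\ast\nabla w)\cdot\nabla\psi\Big)dx\le\int_\Omega (h_n\ast f)\,\psi\,dx\qquad\text{for a.a. } t\in(0,T).$$ Then, for every $n\ge1$, $k_n$ has a weak derivative $\dot k_n\in L_{1,loc}([0,\infty))$ on $(0,\infty)$, $-\dot k_n\ge0$ a.e. (so that the triple integral below is nonnegative), all integrals below converge absolutely, and $$\begin{aligned} &\int_0^T\!\!\int_\Omega w\,(h_n\ast u)\,dx\,dt+\frac12\int_0^T\!\!\int_\Omega\big[k_n(T-t)+k_n(t)\big]\,\big|l\overset{T}{\ast}\nabla w\big|^2\,dx\,dt\\ &\quad+\frac12\int_0^T\!\!\int_0^t\!\!\int_\Omega[-\dot k_n(s)]\,\big|(l\overset{T}{\ast}\nabla w)(t,x)-(l\overset{T}{\ast}\nabla w)(t-s,x)\big|^2\,dx\,ds\,dt\\ &\le\int_0^T\!\!\int_\Omega w\,u_0\,(1\ast h_n)\,dx\,dt+\int_0^T\!\!\int_\Omega(h_n\ast f)\,(l\overset{T}{\ast}w)\,dx\,dt\\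 &\quad+\int_0^T\!\!\int_\Omega\big[(h_n\overset{T}{\ast}\nabla w)-(h_n\ast\nabla w)\big]\cdot(l\overset{T}{\ast}\nabla w)\,dx\,dt. \end{aligned}$$ -/

import Mathlib

open MeasureTheory Set
open scoped ContDiff ENNReal

noncomputable section Kernels

/-- Convolution on the positive half-line in time: `(k * v)(t) = ∫_0^t k(t - τ) v(τ) dτ`. -/
def timeConv {F : Type*} [NormedAddCommGroup F] [NormedSpace ℝ F]
    (k : ℝ → ℝ) (v : ℝ → F) (t : ℝ) : F :=
  ∫ τ in (0 : ℝ)..t, k (t - τ) • v τ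

/-- Dual convolution on the interval `(0, T)`: `∫_t^T f(τ - t) g(τ) dτ`. -/
def dualConv {F : Type*} [NormedAddCommGroup F] [NormedSpace ℝ F]
    (T : ℝ) (f : ℝ → ℝ) (g : ℝ → F) (t : ℝ) : F :=
  ∫ τ in t..T, f (τ - t) • g τ

/-- `(k * v)(t, x)` for a function `v` of `(t, x)`; the convolution is in time. -/
def timeConvX {X F : Type*} [NormedAddCommGroup F] [NormedSpace ℝ F]
    (k : ℝ → ℝ) (v : ℝ → X → F) (t : ℝ) (x : X) : F :=
  timeConv k (fun τ => v τ x) t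

/-- The dual convolution in time, on `(0, T)`, of `f` with a function `g` of `(t, x)`. -/
def dualConvX {X F : Type*} [NormedAddCommGroup F] [NormedSpace ℝ F]
    (T : ℝ) (f : ℝ → ℝ) (g : ℝ → X → F) (t : ℝ) (x : X) : F :=
  dualConv T f (fun τ => g τ x) t

/-- `(k, l) ∈ PC`: `k` and `l` are in `L¹_loc([0, ∞))`, `k` is nonnegative and nonincreasing, and
`k * l = 1` on `(0, ∞)` (as elements of `L¹_loc`). Nothing is required of the sign of `l`. -/
structure IsPCPair (k l : ℝ → ℝ) : Prop where
  locallyIntegrable_k : LocallyIntegrableOn k (Ici 0)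
  nonneg_k : ∀ t, 0 < t → 0 ≤ k t
  antitone_k : AntitoneOn k (Ioi 0)
  locallyIntegrable_l : LocallyIntegrableOn l (Ici 0)
  conv_eq_one : ∀ᵐ t ∂volume.restrict (Ioi (0 : ℝ)), timeConv k l t = 1

/-- `h` is a resolvent kernel of `γ l`: `h ∈ L¹_loc([0, ∞))` and `h + γ (h * l) = γ l`. -/
def IsResolventKernel (γ : ℝ) (l h : ℝ → ℝ) : Prop :=
  LocallyIntegrableOn h (Ici 0) ∧
    ∀ᵐ t ∂volume.restrict (Ioi (0 : ℝ)), h t + γ * timeConv h l t = γ * l t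

/-- Terms of the Neumann series of the convolution operator with kernel `a`; only used to prove
that resolvent kernels exist. -/
def neumannTerm (a : ℝ → ℝ) : ℕ → ℝ → ℝ
  | 0 => a
  | j + 1 => fun t => -∫ τ, neumannTerm a j (t - τ) * a τ

/-- Majorants of the terms of the Neumann series. -/
def neumannBound (a : ℝ → ℝ) : ℕ → ℝ → ℝ≥0∞
  | 0 => fun t => ‖a t‖ₑ
  | j + 1 => fun t => ∫⁻ τ, neumannBound a j (t - τ) * ‖a τ‖ₑ

theorem enorm_neumannTerm_le (a : ℝ → ℝ) (j : ℕ) (t : ℝ) :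
    ‖neumannTerm a j t‖ₑ ≤ neumannBound a j t := by
  induction j generalizing t with
  | zero => simp [neumannTerm, neumannBound]
  | succ j ih =>
    simp only [neumannTerm, neumannBound, enorm_neg]
    refine (enorm_integral_le_lintegral_enorm _).trans (lintegral_mono fun τ => ?_)
    rw [enorm_mul]
    gcongr
    exact ih _

theorem neumannBound_eq_zero {a : ℝ → ℝ} (ha : ∀ t ≤ 0, a t = 0) (j : ℕ) {t : ℝ} (ht : t ≤ 0) :
    neumannBound a j t = 0 := by
  induction j generalizing t with
  | zero => simp [neumannBound, ha t ht]
  | succ j ih =>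
    simp only [neumannBound]
    rw [← lintegral_zero (α := ℝ) (μ := volume)]
    congr 1
    ext τ
    rcases le_or_gt τ 0 with h | h
    · simp [ha τ h]
    · simp [ih (t := t - τ) (by linarith)]

theorem measurable_neumannBound {a : ℝ → ℝ} (ha : Measurable a) (j : ℕ) :
    Measurable (neumannBound a j) := by
  induction j with
  | zero => exact ha.enorm
  | succ j ih =>
    simp only [neumannBound]
    refine Measurable.lintegral_prod_right' (f := fun p : ℝ × ℝ => neumannBound a j (p.1 - p.2) * ‖a p.2‖ₑ) ?_
    exact (ih.comp (measurable_fst.sub measurable_snd)).mul (ha.comp measurable_snd).enorm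

theorem measurable_neumannTerm {a : ℝ → ℝ} (ha : Measurable a) (j : ℕ) :
    Measurable (neumannTerm a j) := by
  induction j with
  | zero => exact ha
  | succ j ih =>
    simp only [neumannTerm]
    refine Measurable.neg ?_
    refine StronglyMeasurable.measurable ?_
    refine StronglyMeasurable.integral_prod_right' (f := fun p : ℝ × ℝ => neumannTerm a j (p.1 - p.2) * a p.2) ?_
    exact ((ih.comp (measurable_fst.sub measurable_snd)).mul (ha.comp measurable_snd)).stronglyMeasurable

theorem neumann_finite {a : ℝ → ℝ} (ham : Measurable a) (ha : ∀ t ≤ 0, a t = 0) {M : ℝ}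
    (hi : IntegrableOn a (Iio M)) : ∫⁻ t in Iio M, ∑' j, neumannBound a j t ≠ ⊤ := by
  set e : ℕ → ℝ → ℝ≥0∞ := fun n t => ENNReal.ofReal (Real.exp (-(n * t))) with he
  have hem : ∀ n, Measurable (e n) := fun n => by simp only [he]; fun_prop
  have hlim : Filter.Tendsto (fun n => ∫⁻ t in Iio M, e n t * ‖a t‖ₑ) Filter.atTop
      (nhds (∫⁻ t in Iio M, (0 : ℝ≥0∞))) := by
    refine tendsto_lintegral_of_dominated_convergence (fun t => ‖a t‖ₑ)
      (fun n => (hem n).mul ham.enorm) (fun n => ?_) hi.2.ne ?_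
    · refine Filter.Eventually.of_forall fun t => ?_
      rcases le_or_gt t 0 with h | h
      · simp [ha t h]
      · have : e n t ≤ 1 := by
          simp only [he]
          rw [← ENNReal.ofReal_one]
          refine ENNReal.ofReal_le_ofReal (Real.exp_le_one_iff.2 ?_)
          have : (0 : ℝ) ≤ n * t := by positivity
          linarith
        calc e n t * ‖a t‖ₑ ≤ 1 * ‖a t‖ₑ := by gcongr
          _ = _ := one_mul _
    · refine Filter.Eventually.of_forall fun t => ?_
      rcases le_or_gt t 0 with h | h
      · simp [ha t h]
      · have h1 : Filter.Tendsto (fun n : ℕ => e n t) Filter.atTop (nhds 0) := by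
          simp only [he]
          rw [← ENNReal.ofReal_zero]
          refine ENNReal.tendsto_ofReal ?_
          refine Real.tendsto_exp_neg_atTop_nhds_zero.comp ?_
          exact Filter.Tendsto.atTop_mul_const h tendsto_natCast_atTop_atTop
        have := ENNReal.Tendsto.mul_const (b := ‖a t‖ₑ) h1 (Or.inr enorm_ne_top)
        simpa using this
  rw [lintegral_zero] at hlim
  obtain ⟨n, hn⟩ := (hlim.eventually (gt_mem_nhds (show (0 : ℝ≥0∞) < 1 by simp))).exists
  set q := ∫⁻ t in Iio M, e n t * ‖a t‖ₑ with hq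
  have hstep : ∀ j, ∫⁻ t in Iio M, e n t * neumannBound a j t ≤ q ^ (j + 1) := by
    intro j
    induction j with
    | zero => simp [neumannBound, hq]
    | succ j ih =>
      set A : ℝ → ℝ≥0∞ := (Iio M).indicator fun t => e n t * ‖a t‖ₑ with hA
      set B : ℝ → ℝ≥0∞ := (Iio M).indicator fun t => e n t * neumannBound a j t with hB
      have hAm : Measurable A := ((hem n).mul ham.enorm).indicator measurableSet_Iio
      have hBm : Measurable B :=
        ((hem n).mul (measurable_neumannBound ham j)).indicator measurableSet_Iio
      have hpt : ∀ t ∈ Iio M, e n t * neumannBound a (j + 1) t ≤ ∫⁻ τ, B (t - τ) * A τ := by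
        intro t ht
        simp only [neumannBound]
        rw [← lintegral_const_mul' _ _ (by simp [he])]
        refine lintegral_mono fun τ => ?_
        rcases le_or_gt τ 0 with h | h
        · simp [ha τ h]
        rcases le_or_gt t τ with h' | h'
        · simp [neumannBound_eq_zero ha j (t := t - τ) (by linarith)]
        have ht' : t < M := ht
        have m1 : t - τ ∈ Iio M := by simp only [mem_Iio]; linarith
        have m2 : τ ∈ Iio M := by simp only [mem_Iio]; linarith
        simp only [hA, hB, indicator_of_mem m1, indicator_of_mem m2]
        have : e n t = e n (t - τ) * e n τ := by
          simp only [he]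
          rw [← ENNReal.ofReal_mul (Real.exp_pos _).le, ← Real.exp_add]
          congr 2; ring
        rw [this]
        apply le_of_eq; ring
      calc ∫⁻ t in Iio M, e n t * neumannBound a (j + 1) t
          ≤ ∫⁻ t in Iio M, ∫⁻ τ, B (t - τ) * A τ := setLIntegral_mono' measurableSet_Iio hpt
        _ ≤ ∫⁻ t, ∫⁻ τ, B (t - τ) * A τ := setLIntegral_le_lintegral _ _
        _ = ∫⁻ τ, ∫⁻ t, B (t - τ) * A τ := by
            refine lintegral_lintegral_swap (Measurable.aemeasurable ?_)
            exact (hBm.comp (measurable_fst.sub measurable_snd)).mul (hAm.comp measurable_snd)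
        _ = ∫⁻ τ, (∫⁻ t, B t) * A τ := by
            congr 1; ext τ
            have h1 : Measurable fun t => B (t - τ) := hBm.comp (measurable_id.sub_const τ)
            rw [lintegral_mul_const _ h1, lintegral_sub_right_eq_self B τ]
        _ = (∫⁻ t, B t) * q := by
            rw [lintegral_const_mul _ hAm]
            simp only [hA, lintegral_indicator measurableSet_Iio, hq]
        _ ≤ q ^ (j + 1) * q := by
            rw [hB, lintegral_indicator measurableSet_Iio]
            gcongr
        _ = q ^ (j + 1 + 1) := (pow_succ _ _).symm
  have hsum : ∫⁻ t in Iio M, ∑' j, e n t * neumannBound a j t ≠ ⊤ := by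
    have hmj : ∀ j, AEMeasurable (fun t => e n t * neumannBound a j t)
        (volume.restrict (Iio M)) :=
      fun j => ((hem n).mul (measurable_neumannBound ham j)).aemeasurable
    rw [lintegral_tsum hmj]
    refine ne_top_of_le_ne_top ?_ (ENNReal.tsum_le_tsum hstep)
    simp only [pow_succ]
    rw [ENNReal.tsum_mul_right, ENNReal.tsum_geometric]
    refine ENNReal.mul_ne_top (ENNReal.inv_ne_top.2 ?_) hn.ne_top
    rw [Ne, tsub_eq_zero_iff_le, not_le]
    exact hn
  have hle : ∀ t ∈ Iio M, ∑' j, neumannBound a j t ≤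
      ENNReal.ofReal (Real.exp (n * M)) * ∑' j, e n t * neumannBound a j t := by
    intro t ht
    rw [ENNReal.tsum_mul_left, ← mul_assoc]
    have : 1 ≤ ENNReal.ofReal (Real.exp (n * M)) * e n t := by
      simp only [he]
      rw [← ENNReal.ofReal_mul (Real.exp_pos _).le, ← Real.exp_add, ← ENNReal.ofReal_one]
      refine ENNReal.ofReal_le_ofReal (Real.one_le_exp ?_)
      have : (n : ℝ) * t ≤ n * M := by gcongr; exact (mem_Iio.1 ht).le
      linarith
    calc ∑' j, neumannBound a j t = 1 * ∑' j, neumannBound a j t := (one_mul _).symm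
      _ ≤ _ := by gcongr
  refine ne_top_of_le_ne_top ?_ (setLIntegral_mono' measurableSet_Iio hle)
  rw [lintegral_const_mul' _ _ ENNReal.ofReal_ne_top]
  exact ENNReal.mul_ne_top ENNReal.ofReal_ne_top hsum

theorem exists_isResolventKernel (γ : ℝ) {l : ℝ → ℝ} (hl : LocallyIntegrableOn l (Ici 0)) :
    ∃ h, IsResolventKernel γ l h := by
  have hlm : AEStronglyMeasurable l (volume.restrict (Ioi (0 : ℝ))) :=
    hl.aestronglyMeasurable.mono_measure (Measure.restrict_mono Ioi_subset_Ici_self le_rfl)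
  set l' := hlm.mk l with hl'
  have hll' : ∀ᵐ t ∂volume, t ∈ Ioi (0 : ℝ) → l t = l' t :=
    (ae_restrict_iff' measurableSet_Ioi).1 hlm.ae_eq_mk
  set a : ℝ → ℝ := (Ioi (0 : ℝ)).indicator fun t => γ * l' t with hadef
  have ham : Measurable a :=
    (hlm.stronglyMeasurable_mk.measurable.const_mul γ).indicator measurableSet_Ioi
  have ha0 : ∀ t ≤ 0, a t = 0 := fun t ht => indicator_of_notMem (by simpa using ht) _
  have hal : ∀ᵐ t ∂volume, t ∈ Ioi (0 : ℝ) → a t = γ * l t := by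
    filter_upwards [hll'] with t ht h
    rw [hadef, indicator_of_mem h, ht h]
  have hai : ∀ M : ℝ, IntegrableOn a (Iio M) := by
    intro M
    have h1 : IntegrableOn l (Icc 0 M) :=
      hl.integrableOn_compact_subset Icc_subset_Ici_self isCompact_Icc
    have h2 : IntegrableOn (fun t => γ * l t) (Ioo 0 M) :=
      Integrable.const_mul (h1.mono_set Ioo_subset_Icc_self) γ
    have h3 : IntegrableOn a (Ioo 0 M) := by
      refine h2.congr_fun_ae ?_
      rw [Filter.EventuallyEq, ae_restrict_iff' measurableSet_Ioo]
      filter_upwards [hal] with t ht h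
      exact (ht h.1).symm
    refine IntegrableOn.of_forall_sdiff_eq_zero h3 measurableSet_Iio fun t ht => ?_
    refine ha0 t ?_
    by_contra hc
    exact ht.2 ⟨not_le.1 hc, ht.1⟩
  have hfin : ∀ᵐ t ∂volume, ∑' j, neumannBound a j t ≠ ⊤ := by
    have : ∀ M : ℕ, ∀ᵐ t ∂volume, t ∈ Iio (M : ℝ) → ∑' j, neumannBound a j t ≠ ⊤ := by
      intro M
      rw [← ae_restrict_iff' measurableSet_Iio]
      filter_upwards [ae_lt_top (Measurable.tsum fun j => measurable_neumannBound ham j)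
        (neumann_finite ham ha0 (hai M))] with t ht
      exact ht.ne
    filter_upwards [ae_all_iff.2 this] with t ht
    obtain ⟨M, hM⟩ := exists_nat_gt t
    exact ht M hM
  set h : ℝ → ℝ := fun t => ∑' j, neumannTerm a j t with hh
  have hsumm : ∀ t, ∑' j, neumannBound a j t ≠ ⊤ → Summable fun j => neumannTerm a j t := by
    intro t ht
    have : ∑' j, ‖neumannTerm a j t‖ₑ ≠ ⊤ :=
      ne_top_of_le_ne_top ht (ENNReal.tsum_le_tsum fun j => enorm_neumannTerm_le a j t)
    exact Summable.of_enorm this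
  have hb : ∀ t, ‖h t‖ₑ ≤ ∑' j, neumannBound a j t := by
    intro t
    exact enorm_tsum_le_tsum_enorm.trans (ENNReal.tsum_le_tsum fun j => enorm_neumannTerm_le a j t)
  have hmeas : AEStronglyMeasurable h volume := by
    refine aestronglyMeasurable_of_tendsto_ae Filter.atTop
      (f := fun n t => ∑ j ∈ Finset.range n, neumannTerm a j t)
      (fun n => (Finset.measurable_fun_sum _ fun j _ =>
        measurable_neumannTerm ham j).aestronglyMeasurable) ?_
    filter_upwards [hfin] with t ht
    exact (hsumm t ht).hasSum.tendsto_sum_nat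
  have h0 : ∀ t ≤ 0, h t = 0 := by
    intro t ht
    have := hb t
    simpa [neumannBound_eq_zero ha0 _ ht] using this
  refine ⟨h, ?_, ?_⟩
  · refine LocallyIntegrable.locallyIntegrableOn ?_ _
    refine locallyIntegrable_iff.2 fun K hK => ?_
    obtain ⟨M, hM⟩ := hK.bddAbove
    refine IntegrableOn.mono_set (t := Iio (M + 1)) ⟨hmeas.restrict, ?_⟩
      fun t ht => (hM ht).trans_lt (lt_add_one M)
    exact (lintegral_mono hb).trans_lt (neumann_finite ham ha0 (hai _)).lt_top
  · rw [ae_restrict_iff' measurableSet_Ioi]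
    filter_upwards [hfin, hal] with t ht hat hpos
    have hpos' : (0 : ℝ) < t := hpos
    have e1 : γ * timeConv h l t = ∫ τ, h (t - τ) * a τ := by
      rw [timeConv, intervalIntegral.integral_of_le hpos'.le, ← integral_const_mul,
        ← integral_indicator measurableSet_Ioc]
      refine integral_congr_ae ?_
      filter_upwards [hal] with τ hτ
      by_cases hm : τ ∈ Ioc 0 t
      · rw [indicator_of_mem hm, hτ hm.1, smul_eq_mul]; ring
      · rw [indicator_of_notMem hm]
        rcases le_or_gt τ 0 with h' | h'
        · simp [ha0 τ h']
        · have : t < τ := by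
            by_contra hc
            exact hm ⟨h', not_lt.1 hc⟩
          simp [h0 (t - τ) (by linarith)]
    have e2 : ∫ τ, h (t - τ) * a τ = ∑' j, ∫ τ, neumannTerm a j (t - τ) * a τ := by
      simp only [hh, ← tsum_mul_right]
      refine integral_tsum (fun j => ?_) ?_
      · exact (((measurable_neumannTerm ham j).comp
          (measurable_const.sub measurable_id)).mul ham).aestronglyMeasurable
      · refine ne_top_of_le_ne_top ht ?_
        refine le_trans (ENNReal.tsum_le_tsum (g := fun j => neumannBound a (j + 1) t) fun j => ?_) ?_
        · simp only [neumannBound]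
          refine lintegral_mono fun τ => ?_
          rw [enorm_mul]
          gcongr
          exact enorm_neumannTerm_le a j _
        · exact ENNReal.tsum_comp_le_tsum_of_injective (add_left_injective 1) _
    have e3 : h t = a t - ∑' j, ∫ τ, neumannTerm a j (t - τ) * a τ := by
      simp only [hh]
      rw [(hsumm t ht).tsum_eq_zero_add]
      simp only [neumannTerm, tsum_neg]
      ring
    rw [e1, e2, e3, ← hat hpos]
    ring

open Classical in
/-- The resolvent kernel `h_γ` of `γ l`, for `l ∈ L¹_loc([0, ∞))`. -/
def resolventKernel (γ : ℝ) (l : ℝ → ℝ) : ℝ → ℝ :=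
  if hex : ∃ h, IsResolventKernel γ l h then hex.choose else 0

theorem isResolventKernel_resolventKernel (γ : ℝ) {l : ℝ → ℝ}
    (hl : LocallyIntegrableOn l (Ici 0)) : IsResolventKernel γ l (resolventKernel γ l) := by
  have hex := exists_isResolventKernel γ hl
  rw [resolventKernel, dif_pos hex]
  exact hex.choose_spec

/-- The regularized kernel `k_γ = k * h_γ`. -/
def regKernel (γ : ℝ) (k l : ℝ → ℝ) : ℝ → ℝ :=
  timeConv k (resolventKernel γ l)

end Kernels

section FunctionSpaces

/-- `φ ∈ C_c^∞(U)`. -/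
def IsTestFunction {V : Type*} [NormedAddCommGroup V] [NormedSpace ℝ V]
    (U : Set V) (φ : V → ℝ) : Prop :=
  ContDiff ℝ ∞ φ ∧ HasCompactSupport φ ∧ tsupport φ ⊆ U

/-- `g ∈ L¹_loc(U)` is the weak derivative of `v ∈ L¹_loc(U)` in the direction `e` on `U`. -/
def HasWeakDerivOn {V : Type*} [NormedAddCommGroup V] [NormedSpace ℝ V] [MeasureSpace V]
    (U : Set V) (e : V) (v g : V → ℝ) : Prop :=
  LocallyIntegrableOn v U ∧ LocallyIntegrableOn g U ∧
    ∀ φ : V → ℝ, IsTestFunction U φ →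
      ∫ x in U, v x * fderiv ℝ φ x e = -∫ x in U, g x * φ x

/-- `ψ ∈ H¹₂(Ω)` with weak gradient `G`. -/
def IsH1 {N : ℕ} (Ω : Set (EuclideanSpace ℝ (Fin N)))
    (ψ : EuclideanSpace ℝ (Fin N) → ℝ)
    (G : EuclideanSpace ℝ (Fin N) → EuclideanSpace ℝ (Fin N)) : Prop :=
  MemLp ψ 2 (volume.restrict Ω) ∧ MemLp G 2 (volume.restrict Ω) ∧
    ∀ e : EuclideanSpace ℝ (Fin N), HasWeakDerivOn Ω e ψ (fun x => inner ℝ (G x) e)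

/-- `ψ` is in the closure of `C_c^∞(Ω)` in `H¹₂(Ω)`, with weak gradient `G`. -/
def IsH10 {N : ℕ} (Ω : Set (EuclideanSpace ℝ (Fin N)))
    (ψ : EuclideanSpace ℝ (Fin N) → ℝ)
    (G : EuclideanSpace ℝ (Fin N) → EuclideanSpace ℝ (Fin N)) : Prop :=
  IsH1 Ω ψ G ∧ ∀ ε : ℝ≥0∞, 0 < ε → ∃ φ : EuclideanSpace ℝ (Fin N) → ℝ, IsTestFunction Ω φ ∧
    eLpNorm (fun x => ψ x - φ x) 2 (volume.restrict Ω) < ε ∧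
    eLpNorm (fun x => G x - gradient φ x) 2 (volume.restrict Ω) < ε

/-- `v ∈ L₂(Ω_T; F)`, where `Ω_T = (0, T) × Ω`. -/
def IsL2Cyl {N : ℕ} {F : Type*} [NormedAddCommGroup F] (T : ℝ)
    (Ω : Set (EuclideanSpace ℝ (Fin N))) (v : ℝ → EuclideanSpace ℝ (Fin N) → F) : Prop :=
  MemLp (Function.uncurry v) 2 (volume.restrict (Ioo 0 T ×ˢ Ω))

/-- `w ∈ L₂((0, T); V)` with weak spatial gradient `gw`, where `V` is `IsH1 Ω` or `IsH10 Ω`. -/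
def IsL2V {N : ℕ} (T : ℝ) (Ω : Set (EuclideanSpace ℝ (Fin N)))
    (V : (EuclideanSpace ℝ (Fin N) → ℝ) →
      (EuclideanSpace ℝ (Fin N) → EuclideanSpace ℝ (Fin N)) → Prop)
    (w : ℝ → EuclideanSpace ℝ (Fin N) → ℝ)
    (gw : ℝ → EuclideanSpace ℝ (Fin N) → EuclideanSpace ℝ (Fin N)) : Prop :=
  IsL2Cyl T Ω w ∧ IsL2Cyl T Ω gw ∧ ∀ᵐ t ∂volume.restrict (Ioo 0 T), V (w t) (gw t)

/-- `k * u ∈ C([0, T]; L₂(Ω))` with `(k * u)|_{t = 0} = 0`: the function `k * u` agrees a.e. on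
`Ω_T` with a continuous `L₂(Ω)`-valued function on `[0, T]` that vanishes at `0`. -/
def ConvContinuousVanishing {N : ℕ} (T : ℝ) (Ω : Set (EuclideanSpace ℝ (Fin N))) (k : ℝ → ℝ)
    (u : ℝ → EuclideanSpace ℝ (Fin N) → ℝ) : Prop :=
  ∃ v : ℝ → Lp ℝ 2 (volume.restrict Ω), ContinuousOn v (Icc 0 T) ∧ v 0 = 0 ∧
    ∀ᵐ t ∂volume.restrict (Ioo 0 T),
      v t =ᵐ[volume.restrict Ω] timeConvX k u t

/-- The time-regularized weak inequality: for every nonnegative `ψ ∈ V`, for a.e. `t ∈ (0, T)`,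
`∫_Ω (ψ ∂_t(k_γ * [u - u₀]) + (h_γ * ∇w) · ∇ψ) dx ≤ ∫_Ω (h_γ * f) ψ dx`.
Here `dv` is the weak time derivative of `k_γ * [u - u₀]` on `Ω_T`, which is unique a.e. -/
def RegularizedWeakIneq {N : ℕ} (T : ℝ) (Ω : Set (EuclideanSpace ℝ (Fin N)))
    (V : (EuclideanSpace ℝ (Fin N) → ℝ) →
      (EuclideanSpace ℝ (Fin N) → EuclideanSpace ℝ (Fin N)) → Prop)
    (γ : ℝ) (k l : ℝ → ℝ) (u₀ : EuclideanSpace ℝ (Fin N) → ℝ)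
    (f u : ℝ → EuclideanSpace ℝ (Fin N) → ℝ)
    (gw : ℝ → EuclideanSpace ℝ (Fin N) → EuclideanSpace ℝ (Fin N)) : Prop :=
  ∀ dv : ℝ → EuclideanSpace ℝ (Fin N) → ℝ,
    HasWeakDerivOn (Ioo 0 T ×ˢ Ω) ((1 : ℝ), (0 : EuclideanSpace ℝ (Fin N)))
      (Function.uncurry (timeConvX (regKernel γ k l) fun τ x => u τ x - u₀ x))
      (Function.uncurry dv) →
    ∀ ψ G, V ψ G → (∀ᵐ x ∂volume.restrict Ω, 0 ≤ ψ x) →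
      ∀ᵐ t ∂volume.restrict (Ioo 0 T),
        ∫ x in Ω, (ψ x * dv t x
            + inner ℝ (timeConvX (resolventKernel γ l) gw t x) (G x))
          ≤ ∫ x in Ω, timeConvX (resolventKernel γ l) f t x * ψ x

end FunctionSpaces

/-!
The proof tests the regularized inequality with the dual convolution of `l` and `w`, and then
integrates in time. Three facts carry it.

*Kernels.* If `k` is nonnegative and nonincreasing and `k * l = 1`, then `l ≥ 0`
(`IsPCPair.nonneg_l`). This is a comparison principle: for a nonnegative Lipschitz source `g`, the
function `v = l * g` solves `∂ₜ(k * v) = g`, and at a negative minimum of `v + ε t` the difference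
quotients of `k * (v + ε t)` are both bounded below by a positive number and bounded above by a
null sequence. Applied to the pair `(k + γ, h_γ / γ)` it gives `h_γ ≥ 0`. Convolving the
resolvent equation with `k` gives `k_γ = γ - γ (1 * h_γ)`, so that the weak derivative of `k_γ` is
`-γ h_γ ≤ 0` and that of `k_γ * v` is `γ v - γ (h_γ * v)`.

*Testing.* No density argument is needed in order to insert a time-dependent test function. For
almost every `τ` the function `w(τ)` itself lies in `V`, so the inequality may be tested at almost
every `t` with `w(τ)`; multiplying by `l(τ - t) ≥ 0`, integrating over `0 < t < τ < T` and applying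
Fubini's theorem moves `l` either to the left, as a convolution, or to the right, as a dual
convolution (`integral_inner_dualConvX_le`). Since `l * ∂ₜ(k_γ * [u - u₀]) = h_γ * u - u₀ (1 * h_γ)`,
the first two terms of the duality inequality appear.

*Energy.* For the dual convolution `g` of `l` and `∇w`, the resolvent equation writes the dual
convolution of `h_γ` and `∇w` as `γ g` minus `γ` times the dual convolution of `h_γ` and `g`, and
polarization under the triple integral, `2⟪a, b⟫ = |a|² + |b|² - |a - b|²`, turns its pairing with
`g` into the two energy terms (`IsResolventKernel.integral_inner_dualConvX`).

All the integrability comes from one Schur test (`IsSchurKernel`), applied to the kernel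
`(t, τ) ↦ a (t - τ)` on `(0, T)` for a locally integrable `a`.
-/

/-! ### Convolutions on a bounded time interval and the resolvent equation -/

section Volterra

open scoped Convolution
open ContinuousLinearMap (lsmul)

variable {F : Type*} [NormedAddCommGroup F] [NormedSpace ℝ F]

theorem timeConv_eq_setIntegral (k : ℝ → ℝ) (v : ℝ → F) {t : ℝ} (ht : 0 ≤ t) :
    timeConv k v t = ∫ τ in Ioo 0 t, k (t - τ) • v τ := by
  rw [timeConv, intervalIntegral.integral_of_le ht, integral_Ioc_eq_integral_Ioo]

theorem dualConv_eq_setIntegral {T : ℝ} (k : ℝ → ℝ) (v : ℝ → F) {t : ℝ} (ht : t ≤ T) :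
    dualConv T k v t = ∫ τ in Ioo t T, k (τ - t) • v τ := by
  rw [dualConv, intervalIntegral.integral_of_le ht, integral_Ioc_eq_integral_Ioo]

theorem timeConv_comm (a b : ℝ → ℝ) (t : ℝ) : timeConv a b t = timeConv b a t := by
  have h := intervalIntegral.integral_comp_sub_left (fun τ => b (t - τ) * a τ) t (a := 0) (b := t)
  simp only [sub_sub_cancel, sub_self, sub_zero] at h
  simp only [timeConv, smul_eq_mul, ← h]
  simp only [mul_comm]

theorem timeConv_one_left (h : ℝ → ℝ) (t : ℝ) :
    timeConv (fun _ => 1) h t = ∫ τ in (0 : ℝ)..t, h τ := by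
  simp [timeConv]

/-- Time reversal turns the dual convolution into the convolution. -/
theorem dualConv_eq_timeConv_reflect (T : ℝ) (a : ℝ → ℝ) (v : ℝ → F) (t : ℝ) :
    dualConv T a v t = timeConv a (fun s => v (T - s)) (T - t) := by
  have h := intervalIntegral.integral_comp_sub_left (fun τ => a (τ - t) • v τ) T
    (a := 0) (b := T - t)
  simp only [sub_sub_cancel, sub_zero] at h
  rw [dualConv, timeConv, ← h]
  refine intervalIntegral.integral_congr fun s _ => ?_
  simp only [sub_right_comm]

/-- The convolution on the half-line is the convolution on `ℝ` of extensions by zero. -/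
theorem timeConv_eq_convolution {a A : ℝ → ℝ} {v V : ℝ → F} {t : ℝ} (ht : 0 ≤ t)
    (hA : EqOn A a (Ioo 0 t)) (hV : EqOn V v (Ioo 0 t)) (hA0 : ∀ s ≤ 0, A s = 0)
    (hV0 : ∀ s ≤ 0, V s = 0) : timeConv a v t = (A ⋆[lsmul ℝ ℝ] V) t := by
  rw [timeConv_eq_setIntegral _ _ ht, convolution_lsmul_swap, ← integral_indicator measurableSet_Ioo]
  congr 1
  ext τ
  by_cases hτ : τ ∈ Ioo 0 t
  · rw [indicator_of_mem hτ, hV hτ, hA ⟨by linarith [hτ.2], by linarith [hτ.1]⟩]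
  · rw [indicator_of_notMem hτ]
    rcases le_or_gt τ 0 with h | h
    · simp [hV0 τ h]
    · have : t ≤ τ := by
        by_contra hc
        exact hτ ⟨h, not_le.1 hc⟩
      simp [hA0 (t - τ) (by linarith)]

theorem convolution_eq_zero_of_nonpos {A : ℝ → ℝ} {V : ℝ → F} (hA0 : ∀ s ≤ 0, A s = 0)
    (hV0 : ∀ s ≤ 0, V s = 0) {t : ℝ} (ht : t ≤ 0) : (A ⋆[lsmul ℝ ℝ] V) t = 0 := by
  rw [convolution_lsmul_swap, ← integral_zero ℝ F (μ := volume)]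
  congr 1
  ext τ
  rcases le_or_gt τ 0 with h | h
  · simp [hV0 τ h]
  · simp [hA0 (t - τ) (by linarith)]

theorem indicator_Ioo_of_nonpos {M : Type*} [Zero M] {T : ℝ} (v : ℝ → M) : ∀ s ≤ 0, (Ioo 0 T).indicator v s = 0 :=
  fun _ hs => indicator_of_notMem (fun h => absurd h.1 (not_lt.2 hs)) _

theorem eqOn_indicator_Ioo {M : Type*} [Zero M] {T t : ℝ} (ht : t ≤ T) (v : ℝ → M) :
    EqOn ((Ioo 0 T).indicator v) v (Ioo 0 t) :=
  fun _ hs => indicator_of_mem (s := Ioo 0 T) ⟨hs.1, hs.2.trans_le ht⟩ _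

theorem timeConv_eq_convolution_indicator {T t : ℝ} (ht : t ∈ Icc 0 T) (a : ℝ → ℝ) (v : ℝ → F) :
    timeConv a v t =
      ((Ioo 0 T).indicator a ⋆[lsmul ℝ ℝ] (Ioo 0 T).indicator v) t :=
  timeConv_eq_convolution ht.1 (eqOn_indicator_Ioo ht.2 a) (eqOn_indicator_Ioo ht.2 v)
    (indicator_Ioo_of_nonpos a) (indicator_Ioo_of_nonpos v)

theorem ae_sub_left_Ioo {T t : ℝ} (ht : t ≤ T) {p : ℝ → Prop}
    (h : ∀ᵐ s ∂volume.restrict (Ioo 0 T), p s) :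
    ∀ᵐ s ∂volume.restrict (Ioo 0 t), p (t - s) := by
  rw [ae_restrict_iff' measurableSet_Ioo] at h ⊢
  have := (quasiMeasurePreserving_sub_left_of_right_invariant volume t).ae h
  filter_upwards [this] with s hs hst
  exact hs ⟨by linarith [hst.2], by linarith [hst.1]⟩

theorem ae_mono_Ioo {T t : ℝ} (ht : t ≤ T) {p : ℝ → Prop}
    (h : ∀ᵐ s ∂volume.restrict (Ioo 0 T), p s) : ∀ᵐ s ∂volume.restrict (Ioo 0 t), p s :=
  ae_mono (Measure.restrict_mono (Ioo_subset_Ioo_right ht) le_rfl) h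

theorem timeConv_congr_ae {T t : ℝ} (ht : t ∈ Icc 0 T) {a a' : ℝ → ℝ} {v v' : ℝ → F}
    (ha : a =ᵐ[volume.restrict (Ioo 0 T)] a') (hv : v =ᵐ[volume.restrict (Ioo 0 T)] v') :
    timeConv a v t = timeConv a' v' t := by
  rw [timeConv_eq_setIntegral _ _ ht.1, timeConv_eq_setIntegral _ _ ht.1]
  refine integral_congr_ae ?_
  filter_upwards [ae_sub_left_Ioo ht.2 ha, ae_mono_Ioo ht.2 hv] with s h1 h2
  simp only [h1, h2]

theorem integrableOn_timeConv {T : ℝ} {a : ℝ → ℝ} {v : ℝ → F} (ha : IntegrableOn a (Ioo 0 T))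
    (hv : IntegrableOn v (Ioo 0 T)) : IntegrableOn (timeConv a v) (Ioo 0 T) := by
  rw [← integrable_indicator_iff measurableSet_Ioo] at ha hv
  refine ((ha.integrable_convolution (lsmul ℝ ℝ) hv).integrableOn (s := Ioo 0 T)).congr_fun
    (fun t ht => ?_) measurableSet_Ioo
  rw [timeConv_eq_convolution_indicator (Ioo_subset_Icc_self ht)]

theorem ae_integrableOn_timeConv {T : ℝ} {a : ℝ → ℝ} {v : ℝ → F} (ha : IntegrableOn a (Ioo 0 T))
    (hv : IntegrableOn v (Ioo 0 T)) : ∀ᵐ t ∂volume.restrict (Ioo 0 T),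
      IntegrableOn (fun τ => a (t - τ) • v τ) (Ioo 0 t) := by
  rw [← integrable_indicator_iff measurableSet_Ioo] at ha hv
  filter_upwards [ae_restrict_of_ae (ha.ae_convolution_exists (lsmul ℝ ℝ) hv),
    ae_restrict_mem measurableSet_Ioo] with t h1 ht
  have h2 := h1.integrable_swap
  refine (h2.integrableOn (s := Ioo 0 t)).congr_fun (fun τ hτ => ?_) measurableSet_Ioo
  have e1 : (t - τ) ∈ Ioo 0 T := ⟨by linarith [hτ.2], by linarith [hτ.1, ht.2]⟩
  have e2 : τ ∈ Ioo 0 T := ⟨hτ.1, hτ.2.trans ht.2⟩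
  simp only [ContinuousLinearMap.lsmul_apply, indicator_of_mem e1, indicator_of_mem e2]

theorem timeConv_smul_sub_smul_right {T : ℝ} {a : ℝ → ℝ} {v v' : ℝ → F}
    (ha : IntegrableOn a (Ioo 0 T)) (hv : IntegrableOn v (Ioo 0 T))
    (hv' : IntegrableOn v' (Ioo 0 T)) (c d : ℝ) :
    ∀ᵐ t ∂volume.restrict (Ioo 0 T), timeConv a (fun s => c • v s - d • v' s) t =
      c • timeConv a v t - d • timeConv a v' t := by
  filter_upwards [ae_integrableOn_timeConv ha hv, ae_integrableOn_timeConv ha hv',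
    ae_restrict_mem measurableSet_Ioo] with t h1 h2 ht
  simp only [timeConv_eq_setIntegral _ _ ht.1.le]
  rw [← integral_smul, ← integral_smul,
    ← integral_sub (Integrable.fun_smul c h1) (Integrable.fun_smul d h2)]
  congr 1
  ext τ
  rw [smul_sub, smul_comm c, smul_comm d]

theorem timeConv_smul_sub_smul_left {T : ℝ} {a b : ℝ → ℝ} {v : ℝ → F}
    (ha : IntegrableOn a (Ioo 0 T)) (hb : IntegrableOn b (Ioo 0 T))
    (hv : IntegrableOn v (Ioo 0 T)) (c d : ℝ) :
    ∀ᵐ t ∂volume.restrict (Ioo 0 T), timeConv (fun s => c * a s - d * b s) v t =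
      c • timeConv a v t - d • timeConv b v t := by
  filter_upwards [ae_integrableOn_timeConv ha hv, ae_integrableOn_timeConv hb hv,
    ae_restrict_mem measurableSet_Ioo] with t h1 h2 ht
  simp only [timeConv_eq_setIntegral _ _ ht.1.le]
  rw [← integral_smul, ← integral_smul,
    ← integral_sub (Integrable.fun_smul c h1) (Integrable.fun_smul d h2)]
  congr 1
  ext τ
  simp only [sub_smul, mul_smul]

/-- Associativity of the convolution on `(0, T)`, from associativity on `ℝ` for the extensions by
zero; values of the inner convolutions beyond `T` do not enter at times `t < T`. -/
theorem timeConv_assoc [CompleteSpace F] {T : ℝ} {a b : ℝ → ℝ} {v : ℝ → F}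
    (ha : IntegrableOn a (Ioo 0 T)) (hb : IntegrableOn b (Ioo 0 T))
    (hv : IntegrableOn v (Ioo 0 T)) :
    ∀ᵐ t ∂volume.restrict (Ioo 0 T),
      timeConv a (timeConv b v) t = timeConv (timeConv a b) v t := by
  rw [← integrable_indicator_iff measurableSet_Ioo] at ha hb hv
  set A := (Ioo 0 T).indicator a with hA
  set B := (Ioo 0 T).indicator b with hB
  set V := (Ioo 0 T).indicator v with hV
  have h3 := ha.norm.ae_convolution_exists (ContinuousLinearMap.mul ℝ ℝ)
    (hb.norm.integrable_convolution (ContinuousLinearMap.mul ℝ ℝ) hv.norm)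
  filter_upwards [ae_restrict_of_ae h3, ae_restrict_mem measurableSet_Ioo] with t h ht
  have hassoc := convolution_assoc (lsmul ℝ ℝ) (lsmul ℝ ℝ) (lsmul ℝ ℝ) (lsmul ℝ ℝ)
    (fun x y z => by simp [mul_smul, smul_comm x y z]) ha.1 hb.1 hv.1
    (ha.ae_convolution_exists (lsmul ℝ ℝ) hb)
    (hb.norm.ae_convolution_exists (ContinuousLinearMap.mul ℝ ℝ) hv.norm) h
  have hsub : ∀ s ∈ Ioo 0 t, s ∈ Icc 0 T := fun s hs => ⟨hs.1.le, (hs.2.trans ht.2).le⟩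
  rw [timeConv_eq_convolution (A := A) (V := B ⋆[lsmul ℝ ℝ] V) ht.1.le
      (eqOn_indicator_Ioo ht.2.le a)
      (fun s hs => (timeConv_eq_convolution_indicator (hsub s hs) b v).symm)
      (indicator_Ioo_of_nonpos a)
      (fun s hs => convolution_eq_zero_of_nonpos (indicator_Ioo_of_nonpos b)
        (indicator_Ioo_of_nonpos v) hs),
    timeConv_eq_convolution (A := A ⋆[lsmul ℝ ℝ] B) (V := V) ht.1.le
      (fun s hs => (timeConv_eq_convolution_indicator (hsub s hs) a b).symm)
      (eqOn_indicator_Ioo ht.2.le v)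
      (fun s hs => convolution_eq_zero_of_nonpos (indicator_Ioo_of_nonpos a)
        (indicator_Ioo_of_nonpos b) hs)
      (indicator_Ioo_of_nonpos v), hassoc]

theorem ae_Ioi_of_forall_Ioo {p : ℝ → Prop}
    (h : ∀ T : ℝ, ∀ᵐ t ∂volume.restrict (Ioo 0 T), p t) : ∀ᵐ t ∂volume.restrict (Ioi (0 : ℝ)), p t := by
  have h' : ∀ M : ℕ, ∀ᵐ t, t ∈ Ioo (0 : ℝ) M → p t :=
    fun M => (ae_restrict_iff' measurableSet_Ioo).1 (h M)
  rw [ae_restrict_iff' measurableSet_Ioi]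
  filter_upwards [ae_all_iff.2 h'] with t ht hpos
  obtain ⟨M, hM⟩ := exists_nat_gt t
  exact ht M ⟨hpos, hM⟩

theorem ae_Ioo_of_Ioi {p : ℝ → Prop} (h : ∀ᵐ t ∂volume.restrict (Ioi (0 : ℝ)), p t) (T : ℝ) :
    ∀ᵐ t ∂volume.restrict (Ioo 0 T), p t :=
  ae_mono (Measure.restrict_mono Ioo_subset_Ioi_self le_rfl) h

theorem integrableOn_Ioo_of_locallyIntegrableOn {E : Type*} [NormedAddCommGroup E]
    {a : ℝ → E} (ha : LocallyIntegrableOn a (Ici 0)) (T : ℝ) : IntegrableOn a (Ioo 0 T) :=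
  (ha.integrableOn_compact_subset Icc_subset_Ici_self isCompact_Icc).mono_set Ioo_subset_Icc_self

namespace IsResolventKernel

variable {γ : ℝ} {k l h : ℝ → ℝ}

theorem ae_eq (hh : IsResolventKernel γ l h) (T : ℝ) :
    h =ᵐ[volume.restrict (Ioo 0 T)] fun t => γ * l t - γ * timeConv h l t := by
  filter_upwards [ae_Ioo_of_Ioi hh.2 T] with t ht
  linarith

/-- `k * h_γ = γ - γ (1 * h_γ)`: convolve the resolvent equation with `k` and use `k * l = 1`. -/
theorem timeConv_eq (hkl : IsPCPair k l) (hh : IsResolventKernel γ l h) :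
    ∀ᵐ t ∂volume.restrict (Ioi (0 : ℝ)), timeConv k h t = γ - γ * ∫ τ in (0 : ℝ)..t, h τ := by
  refine ae_Ioi_of_forall_Ioo fun T => ?_
  have hk := integrableOn_Ioo_of_locallyIntegrableOn hkl.locallyIntegrable_k T
  have hl := integrableOn_Ioo_of_locallyIntegrableOn hkl.locallyIntegrable_l T
  have hi := integrableOn_Ioo_of_locallyIntegrableOn hh.1 T
  have h1 : timeConv k l =ᵐ[volume.restrict (Ioo 0 T)] fun _ => 1 :=
    ae_Ioo_of_Ioi hkl.conv_eq_one T
  filter_upwards [h1, timeConv_smul_sub_smul_right hk hl (integrableOn_timeConv hl hi) γ γ,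
    timeConv_assoc hk hl hi, ae_restrict_mem measurableSet_Ioo] with t e1 e2 e3 ht
  have ht' := Ioo_subset_Icc_self ht
  have e4 : (fun t => γ * l t - γ * timeConv h l t) = fun t => γ • l t - γ • timeConv l h t := by
    ext s
    simp [timeConv_comm h l]
  rw [timeConv_congr_ae ht' (Filter.EventuallyEq.rfl) (hh.ae_eq T), e4, e2, e1, e3,
    timeConv_congr_ae ht' h1 Filter.EventuallyEq.rfl, timeConv_one_left]
  simp

/-- `h_γ * v = γ (l * v) - γ (h_γ * (l * v))`. -/
theorem timeConv_eq_sub [CompleteSpace F] (hl : LocallyIntegrableOn l (Ici 0))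
    (hh : IsResolventKernel γ l h) {T : ℝ}
    {v : ℝ → F} (hv : IntegrableOn v (Ioo 0 T)) :
    ∀ᵐ t ∂volume.restrict (Ioo 0 T),
      timeConv h v t = γ • timeConv l v t - γ • timeConv h (timeConv l v) t := by
  replace hl := integrableOn_Ioo_of_locallyIntegrableOn hl T
  have hi := integrableOn_Ioo_of_locallyIntegrableOn hh.1 T
  filter_upwards [timeConv_smul_sub_smul_left hl (integrableOn_timeConv hi hl) hv γ γ,
    timeConv_assoc hi hl hv, ae_restrict_mem measurableSet_Ioo] with t e2 e3 ht
  rw [timeConv_congr_ae (Ioo_subset_Icc_self ht) (hh.ae_eq T) (Filter.EventuallyEq.rfl), e2, e3]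

/-- The resolvent equation convolved with `v`, in the order needed for
`l * (γ v - γ (h_γ * v)) = h_γ * v`. -/
theorem timeConv_sub_eq [CompleteSpace F] (hl : LocallyIntegrableOn l (Ici 0))
    (hh : IsResolventKernel γ l h) {T : ℝ}
    {v : ℝ → F} (hv : IntegrableOn v (Ioo 0 T)) :
    ∀ᵐ t ∂volume.restrict (Ioo 0 T),
      timeConv l (fun s => γ • v s - γ • timeConv h v s) t = timeConv h v t := by
  replace hl := integrableOn_Ioo_of_locallyIntegrableOn hl T
  have hi := integrableOn_Ioo_of_locallyIntegrableOn hh.1 T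
  filter_upwards [timeConv_smul_sub_smul_right hl hv (integrableOn_timeConv hi hv) γ γ,
    timeConv_smul_sub_smul_left hl (integrableOn_timeConv hi hl) hv γ γ,
    timeConv_assoc hl hi hv, ae_restrict_mem measurableSet_Ioo] with t e1 e2 e3 ht
  rw [e1, timeConv_congr_ae (Ioo_subset_Icc_self ht) (hh.ae_eq T) (Filter.EventuallyEq.rfl), e2, e3]
  congr 3
  ext s
  rw [timeConv_comm]

/-- `k_γ * v = 1 * (γ v - γ (h_γ * v))` for `k_γ = γ - γ (1 * h_γ)`. -/
theorem timeConv_timeConv_eq_integral [CompleteSpace F] (hkl : IsPCPair k l)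
    (hh : IsResolventKernel γ l h) {T : ℝ} {v : ℝ → F} (hv : IntegrableOn v (Ioo 0 T)) :
    ∀ᵐ t ∂volume.restrict (Ioo 0 T),
      timeConv (timeConv k h) v t =
        ∫ τ in (0 : ℝ)..t, (γ • v τ - γ • timeConv h v τ) := by
  have hi := integrableOn_Ioo_of_locallyIntegrableOn hh.1 T
  have h1 : IntegrableOn (fun _ => (1 : ℝ)) (Ioo 0 T) := by simp
  have hkh : timeConv k h =ᵐ[volume.restrict (Ioo 0 T)]
      fun t => γ * 1 - γ * timeConv (fun _ => 1) h t := by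
    filter_upwards [ae_Ioo_of_Ioi (timeConv_eq hkl hh) T] with t ht
    rw [ht, timeConv_one_left, mul_one]
  filter_upwards [timeConv_smul_sub_smul_left h1 (integrableOn_timeConv h1 hi) hv γ γ,
    timeConv_smul_sub_smul_right h1 hv (integrableOn_timeConv hi hv) γ γ,
    timeConv_assoc h1 hi hv, ae_restrict_mem measurableSet_Ioo] with t e1 e2 e3 ht
  rw [timeConv_congr_ae (Ioo_subset_Icc_self ht) hkh (Filter.EventuallyEq.rfl), e1, ← e3, ← e2]
  simp [timeConv]

/-- The dual form of `h_γ * v = γ (l * v) - γ (h_γ * (l * v))`, by time reversal. -/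
theorem dualConv_eq_sub [CompleteSpace F] (hl : LocallyIntegrableOn l (Ici 0))
    (hh : IsResolventKernel γ l h) {T : ℝ}
    {v : ℝ → F} (hv : IntegrableOn v (Ioo 0 T)) :
    ∀ᵐ t ∂volume.restrict (Ioo 0 T),
      dualConv T h v t = γ • dualConv T l v t - γ • dualConv T h (dualConv T l v) t := by
  have hv' : IntegrableOn (fun s => v (T - s)) (Ioo 0 T) := by
    rw [← integrable_indicator_iff measurableSet_Ioo] at hv ⊢
    refine (hv.comp_sub_left T).congr (Filter.Eventually.of_forall fun s => ?_)
    have : T - s ∈ Ioo 0 T ↔ s ∈ Ioo 0 T := by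
      simp only [mem_Ioo]; constructor <;> rintro ⟨h1, h2⟩ <;> constructor <;> linarith
    by_cases hs : s ∈ Ioo 0 T
    · simp only [indicator_of_mem hs, indicator_of_mem (this.2 hs)]
    · simp only [indicator_of_notMem hs, indicator_of_notMem (fun h => hs (this.1 h))]
  filter_upwards [ae_sub_left_Ioo le_rfl (hh.timeConv_eq_sub hl hv')] with t ht
  simp only [dualConv_eq_timeConv_reflect, sub_sub_cancel]
  exact ht

end IsResolventKernel

end Volterra

/-! ### The Schur test and convolution kernels -/

section SchurTest

variable {α X : Type*} [MeasurableSpace α] [MeasurableSpace X] {ν : Measure α} {μ : Measure X}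
  [SFinite ν] [SFinite μ]

/-- A kernel satisfying the hypotheses of the Schur test with exponent `2`: its `L¹` norms in
either variable are bounded uniformly in the other one. -/
structure IsSchurKernel (ν : Measure α) (κ : α → α → ℝ) : Prop where
  aestronglyMeasurable : AEStronglyMeasurable (Function.uncurry κ) (ν.prod ν)
  exists_bound : ∃ C : ℝ≥0∞, C ≠ ⊤ ∧ (∀ t, ∫⁻ τ, ‖κ t τ‖ₑ ∂ν ≤ C) ∧ ∀ τ, ∫⁻ t, ‖κ t τ‖ₑ ∂ν ≤ C

theorem IsSchurKernel.swap {κ : α → α → ℝ} (hκ : IsSchurKernel ν κ) :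
    IsSchurKernel ν fun t τ => κ τ t where
  aestronglyMeasurable := hκ.aestronglyMeasurable.prod_swap
  exists_bound := by
    obtain ⟨C, hC, h1, h2⟩ := hκ.exists_bound
    exact ⟨C, hC, h2, h1⟩

theorem MeasureTheory.MeasurePreserving.integral_comp_of_aestronglyMeasurable {β γ E : Type*}
    [MeasurableSpace β] [MeasurableSpace γ] [NormedAddCommGroup E] [NormedSpace ℝ E]
    {m : Measure β} {m' : Measure γ} {f : β → γ} (hf : MeasurePreserving f m m') {g : γ → E}
    (hg : AEStronglyMeasurable g m') : ∫ x, g (f x) ∂m = ∫ y, g y ∂m' := by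
  conv_rhs => rw [← hf.map_eq]
  rw [integral_map hf.measurable.aemeasurable (by rwa [hf.map_eq])]

theorem measurePreserving_prod_right_comm (ν : Measure α) (μ : Measure X) [SFinite ν] [SFinite μ] :
    MeasurePreserving (fun p : (α × X) × α => ((p.1.1, p.2), p.1.2))
      ((ν.prod μ).prod ν) ((ν.prod ν).prod μ) := by
  have h1 := measurePreserving_prodAssoc ν μ ν
  have h2 := (MeasurePreserving.id ν).prod (Measure.measurePreserving_swap (μ := μ) (ν := ν))
  have h3 := (measurePreserving_prodAssoc ν ν μ).symm
  exact h3.comp (h2.comp h1)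

theorem measurePreserving_swap_prod_id (ν : Measure α) (μ : Measure X) [SFinite ν] [SFinite μ] :
    MeasurePreserving (fun p : (α × α) × X => ((p.1.2, p.1.1), p.2))
      ((ν.prod ν).prod μ) ((ν.prod ν).prod μ) :=
  (Measure.measurePreserving_swap (μ := ν) (ν := ν)).prod (MeasurePreserving.id μ)

theorem quasiMeasurePreserving_fst_prod (ν : Measure α) (μ : Measure X) [SFinite ν] [SFinite μ] :
    Measure.QuasiMeasurePreserving (fun p : (α × α) × X => (p.1.1, p.2))
      ((ν.prod ν).prod μ) (ν.prod μ) :=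
  QuasiMeasurePreserving.prodMap Measure.quasiMeasurePreserving_fst (Measure.QuasiMeasurePreserving.id μ)

theorem quasiMeasurePreserving_snd_prod (ν : Measure α) (μ : Measure X) [SFinite ν] [SFinite μ] :
    Measure.QuasiMeasurePreserving (fun p : (α × α) × X => (p.1.2, p.2))
      ((ν.prod ν).prod μ) (ν.prod μ) :=
  QuasiMeasurePreserving.prodMap Measure.quasiMeasurePreserving_snd (Measure.QuasiMeasurePreserving.id μ)

namespace IsSchurKernel

variable {κ : α → α → ℝ} {F : Type*} [NormedAddCommGroup F] [InnerProductSpace ℝ F]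

omit [SFinite ν] [SFinite μ] in
theorem aestronglyMeasurable_comp (hκ : IsSchurKernel ν κ) :
    AEStronglyMeasurable (fun p : (α × α) × X => κ p.1.1 p.1.2) ((ν.prod ν).prod μ) :=
  hκ.aestronglyMeasurable.comp_fst

theorem integrable_mul_fst (hκ : IsSchurKernel ν κ) {Y : α → X → ℝ}
    (hY : Integrable (Function.uncurry Y) (ν.prod μ)) :
    Integrable (fun p : (α × α) × X => κ p.1.1 p.1.2 * Y p.1.1 p.2) ((ν.prod ν).prod μ) := by
  have hYm : AEStronglyMeasurable (fun p : (α × α) × X => Y p.1.1 p.2) ((ν.prod ν).prod μ) :=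
    hY.1.comp_quasiMeasurePreserving (quasiMeasurePreserving_fst_prod ν μ)
  have hm := hκ.aestronglyMeasurable_comp (μ := μ) |>.mul hYm
  refine ⟨hm, ?_⟩
  obtain ⟨C, hC, h1, -⟩ := hκ.exists_bound
  have hmeas := hm.enorm
  rw [HasFiniteIntegral]
  rw [← (measurePreserving_prod_right_comm ν μ).map_eq, lintegral_map'
    (by rw [(measurePreserving_prod_right_comm ν μ).map_eq]; exact hmeas)
    (measurePreserving_prod_right_comm ν μ).measurable.aemeasurable]
  refine (lintegral_prod _ (hmeas.comp_quasiMeasurePreserving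
    (measurePreserving_prod_right_comm ν μ).quasiMeasurePreserving)).trans_lt ?_
  calc ∫⁻ q : α × X, ∫⁻ τ, ‖κ q.1 τ * Y q.1 q.2‖ₑ ∂ν ∂(ν.prod μ)
      = ∫⁻ q : α × X, (∫⁻ τ, ‖κ q.1 τ‖ₑ ∂ν) * ‖Y q.1 q.2‖ₑ ∂(ν.prod μ) := by
        congr 1
        ext q
        simp only [enorm_mul]
        rw [lintegral_mul_const' _ _ enorm_ne_top]
    _ ≤ ∫⁻ q : α × X, C * ‖Y q.1 q.2‖ₑ ∂(ν.prod μ) := by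
        gcongr with q
        exact h1 _
    _ = C * ∫⁻ q : α × X, ‖Function.uncurry Y q‖ₑ ∂(ν.prod μ) := lintegral_const_mul' _ _ hC
    _ < ⊤ := ENNReal.mul_lt_top hC.lt_top hY.2

theorem integrable_mul_snd (hκ : IsSchurKernel ν κ) {Y : α → X → ℝ}
    (hY : Integrable (Function.uncurry Y) (ν.prod μ)) :
    Integrable (fun p : (α × α) × X => κ p.1.1 p.1.2 * Y p.1.2 p.2) ((ν.prod ν).prod μ) :=
  (measurePreserving_swap_prod_id ν μ).integrable_comp_of_integrable (hκ.swap.integrable_mul_fst hY)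

theorem integral_mul_fst (hκ : IsSchurKernel ν κ) {Y : α → X → ℝ}
    (hY : Integrable (Function.uncurry Y) (ν.prod μ)) :
    ∫ p : (α × α) × X, κ p.1.1 p.1.2 * Y p.1.1 p.2 ∂((ν.prod ν).prod μ) =
      ∫ q : α × X, (∫ τ, κ q.1 τ ∂ν) * Y q.1 q.2 ∂(ν.prod μ) := by
  have hi := hκ.integrable_mul_fst hY
  have hi' := (measurePreserving_prod_right_comm ν μ).integrable_comp_of_integrable hi
  rw [← (measurePreserving_prod_right_comm ν μ).integral_comp_of_aestronglyMeasurable hi.1]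
  refine (integral_prod _ hi').trans ?_
  congr 1
  ext q
  exact integral_mul_const (Y q.1 q.2) fun τ => κ q.1 τ

theorem integrable_integral_mul (hκ : IsSchurKernel ν κ) {Y : α → X → ℝ}
    (hY : Integrable (Function.uncurry Y) (ν.prod μ)) :
    Integrable (fun q : α × X => (∫ τ, κ q.1 τ ∂ν) * Y q.1 q.2) (ν.prod μ) := by
  refine ((measurePreserving_prod_right_comm ν μ).integrable_comp_of_integrable
    (hκ.integrable_mul_fst hY)).integral_prod_left.congr (Filter.Eventually.of_forall fun q => ?_)
  exact integral_mul_const (Y q.1 q.2) fun τ => κ q.1 τ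

theorem integrable_mul_inner (hκ : IsSchurKernel ν κ) {a b : α → X → F}
    (ha : MemLp (Function.uncurry a) 2 (ν.prod μ)) (hb : MemLp (Function.uncurry b) 2 (ν.prod μ)) :
    Integrable (fun p : (α × α) × X => κ p.1.1 p.1.2 * inner ℝ (a p.1.2 p.2) (b p.1.1 p.2))
      ((ν.prod ν).prod μ) := by
  have ha2 := (memLp_two_iff_integrable_sq_norm ha.1).1 ha
  have hb2 := (memLp_two_iff_integrable_sq_norm hb.1).1 hb
  have ham : AEStronglyMeasurable (fun p : (α × α) × X => a p.1.2 p.2) ((ν.prod ν).prod μ) :=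
    ha.1.comp_quasiMeasurePreserving (quasiMeasurePreserving_snd_prod ν μ)
  have hbm : AEStronglyMeasurable (fun p : (α × α) × X => b p.1.1 p.2) ((ν.prod ν).prod μ) :=
    hb.1.comp_quasiMeasurePreserving (quasiMeasurePreserving_fst_prod ν μ)
  refine ((hκ.integrable_mul_snd (Y := fun t x => ‖a t x‖ ^ 2) ha2).norm.add
    (hκ.integrable_mul_fst (Y := fun t x => ‖b t x‖ ^ 2) hb2).norm).mono'
    (hκ.aestronglyMeasurable_comp.mul (ham.inner hbm)) (Filter.Eventually.of_forall fun p => ?_)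
  have h1 := abs_real_inner_le_norm (a p.1.2 p.2) (b p.1.1 p.2)
  simp only [norm_mul, Pi.add_apply, norm_pow, norm_norm, ← mul_add]
  rw [Real.norm_eq_abs (inner ℝ _ _)]
  gcongr
  nlinarith [sq_nonneg (‖a p.1.2 p.2‖ - ‖b p.1.1 p.2‖), sq_nonneg ‖a p.1.2 p.2‖,
    sq_nonneg ‖b p.1.1 p.2‖]

omit [InnerProductSpace ℝ F] in
/-- The estimate behind the Schur test, in terms of lower Lebesgue integrals. -/
theorem lintegral_sq_lt_top (hκ : IsSchurKernel ν κ) {a : α → X → F}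
    (ha : MemLp (Function.uncurry a) 2 (ν.prod μ)) :
    ∫⁻ q : α × X, (∫⁻ τ, ‖κ q.1 τ‖ₑ * ‖a τ q.2‖ₑ ∂ν) ^ 2 ∂(ν.prod μ) < ⊤ := by
  have ha2 := (memLp_two_iff_integrable_sq_norm ha.1).1 ha
  have hi := (measurePreserving_prod_right_comm ν μ).integrable_comp_of_integrable
    (hκ.integrable_mul_snd (Y := fun t x => ‖a t x‖ ^ 2) ha2)
  have hfin := hi.2
  rw [HasFiniteIntegral, lintegral_prod _ hi.1.enorm] at hfin
  obtain ⟨C, hC, h1, -⟩ := hκ.exists_bound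
  -- The Cauchy–Schwarz inequality for the measure `‖κ(t, ·)‖ ν`, of total mass at most `C`.
  have hcs : ∀ᵐ q : α × X ∂(ν.prod μ), (∫⁻ τ, ‖κ q.1 τ‖ₑ * ‖a τ q.2‖ₑ ∂ν) ^ 2 ≤
      C * ∫⁻ τ, ‖κ q.1 τ‖ₑ * ‖a τ q.2‖ₑ ^ 2 ∂ν := by
    have m1 : ∀ᵐ q : α × X ∂(ν.prod μ), AEStronglyMeasurable (fun τ => κ q.1 τ) ν :=
      Measure.quasiMeasurePreserving_fst.ae hκ.aestronglyMeasurable.prodMk_left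
    have m2 : ∀ᵐ q : α × X ∂(ν.prod μ), AEStronglyMeasurable (fun τ => a τ q.2) ν :=
      Measure.quasiMeasurePreserving_snd.ae ha.1.prod_swap.prodMk_left
    filter_upwards [m1, m2] with q hq1 hq2
    have := ENNReal.lintegral_mul_norm_pow_le (p := 1 / 2) (q := 1 / 2) hq1.enorm
      (hq1.enorm.mul (hq2.enorm.pow_const 2)) (by norm_num) (by norm_num) (by norm_num)
    have e : ∀ τ, ‖κ q.1 τ‖ₑ ^ (1 / 2 : ℝ) * (‖κ q.1 τ‖ₑ * ‖a τ q.2‖ₑ ^ 2) ^ (1 / 2 : ℝ) =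
        ‖κ q.1 τ‖ₑ * ‖a τ q.2‖ₑ := by
      intro τ
      rw [ENNReal.mul_rpow_of_nonneg _ _ (by norm_num), ← mul_assoc,
        ← ENNReal.rpow_add_of_nonneg _ _ (by norm_num) (by norm_num), ← ENNReal.rpow_natCast,
        ← ENNReal.rpow_mul]
      norm_num
    simp only [Pi.mul_apply, e] at this
    refine (pow_le_pow_left₀ zero_le this 2).trans ?_
    rw [mul_pow, ← ENNReal.rpow_natCast, ← ENNReal.rpow_mul, ← ENNReal.rpow_natCast,
      ← ENNReal.rpow_mul]
    norm_num
    gcongr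
    exact h1 _
  refine (lintegral_mono_ae hcs).trans_lt ?_
  rw [lintegral_const_mul' _ _ hC]
  refine ENNReal.mul_lt_top hC.lt_top ?_
  simpa only [Function.comp_def, enorm_mul, enorm_pow, enorm_norm] using hfin

/-- The operator with kernel `κ` is given by an absolutely convergent integral almost everywhere. -/
theorem ae_integrable_smul (hκ : IsSchurKernel ν κ) {a : α → X → F}
    (ha : MemLp (Function.uncurry a) 2 (ν.prod μ)) :
    ∀ᵐ q : α × X ∂(ν.prod μ), Integrable (fun τ => κ q.1 τ • a τ q.2) ν := by
  have m1 : ∀ᵐ q : α × X ∂(ν.prod μ), AEStronglyMeasurable (fun τ => κ q.1 τ) ν :=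
    Measure.quasiMeasurePreserving_fst.ae hκ.aestronglyMeasurable.prodMk_left
  have m2 : ∀ᵐ q : α × X ∂(ν.prod μ), AEStronglyMeasurable (fun τ => a τ q.2) ν :=
    Measure.quasiMeasurePreserving_snd.ae ha.1.prod_swap.prodMk_left
  have hmeas : AEMeasurable
      (fun q : α × X => (∫⁻ τ, ‖κ q.1 τ‖ₑ * ‖a τ q.2‖ₑ ∂ν) ^ 2) (ν.prod μ) := by
    refine AEMeasurable.pow_const ?_ 2
    have h1 := (hκ.aestronglyMeasurable_comp (μ := μ)).enorm
    have h2 := (ha.1.comp_quasiMeasurePreserving (quasiMeasurePreserving_snd_prod ν μ)).enorm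
    exact ((h1.mul h2).comp_quasiMeasurePreserving
      (measurePreserving_prod_right_comm ν μ).quasiMeasurePreserving).lintegral_prod_right'
  filter_upwards [m1, m2, ae_lt_top' hmeas (hκ.lintegral_sq_lt_top ha).ne] with q h1 h2 h3
  refine ⟨h1.smul h2, ?_⟩
  rw [HasFiniteIntegral]
  simp only [enorm_smul]
  by_contra hc
  rw [not_lt, top_le_iff] at hc
  simp [hc] at h3

/-- The Schur test: integration against a Schur kernel in the first variable is an operation
on `L²(ν × μ; F)`. -/
theorem memLp_integral_smul (hκ : IsSchurKernel ν κ) {a : α → X → F}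
    (ha : MemLp (Function.uncurry a) 2 (ν.prod μ)) :
    MemLp (fun q : α × X => ∫ τ, κ q.1 τ • a τ q.2 ∂ν) 2 (ν.prod μ) := by
  have hm : AEStronglyMeasurable (fun q : α × X => ∫ τ, κ q.1 τ • a τ q.2 ∂ν) (ν.prod μ) := by
    have h1 := hκ.aestronglyMeasurable_comp (μ := μ)
    have h2 := ha.1.comp_quasiMeasurePreserving (quasiMeasurePreserving_snd_prod ν μ)
    exact ((h1.smul h2).comp_quasiMeasurePreserving
      (measurePreserving_prod_right_comm ν μ).quasiMeasurePreserving).integral_prod_right'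
  rw [memLp_two_iff_integrable_sq_norm hm]
  refine ⟨hm.norm.pow 2, ?_⟩
  refine lt_of_le_of_lt (lintegral_mono fun q => ?_) (hκ.lintegral_sq_lt_top ha)
  simp only [enorm_pow, enorm_norm]
  gcongr
  refine (enorm_integral_le_lintegral_enorm _).trans_eq ?_
  simp only [enorm_smul]

/-- The bilinear form of a Schur kernel as a pairing with the operator of kernel `κ`. -/
theorem integral_mul_inner_left [CompleteSpace F] (hκ : IsSchurKernel ν κ) {a b : α → X → F}
    (ha : MemLp (Function.uncurry a) 2 (ν.prod μ)) (hb : MemLp (Function.uncurry b) 2 (ν.prod μ)) :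
    ∫ p : (α × α) × X, κ p.1.1 p.1.2 * inner ℝ (a p.1.2 p.2) (b p.1.1 p.2) ∂((ν.prod ν).prod μ) =
      ∫ q : α × X, inner ℝ (∫ τ, κ q.1 τ • a τ q.2 ∂ν) (b q.1 q.2) ∂(ν.prod μ) := by
  have hi := hκ.integrable_mul_inner ha hb
  have hi' := (measurePreserving_prod_right_comm ν μ).integrable_comp_of_integrable hi
  rw [← (measurePreserving_prod_right_comm ν μ).integral_comp_of_aestronglyMeasurable hi.1]
  refine (integral_prod _ hi').trans ?_
  refine integral_congr_ae ?_
  filter_upwards [hκ.ae_integrable_smul ha] with q hq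
  rw [real_inner_comm, ← integral_inner hq]
  congr 1
  ext τ
  simp only [Function.comp_apply]
  rw [inner_smul_right, real_inner_comm]

/-- The bilinear form of a Schur kernel as a pairing with the operator of the transposed kernel. -/
theorem integral_mul_inner_right [CompleteSpace F] (hκ : IsSchurKernel ν κ) {a b : α → X → F}
    (ha : MemLp (Function.uncurry a) 2 (ν.prod μ)) (hb : MemLp (Function.uncurry b) 2 (ν.prod μ)) :
    ∫ p : (α × α) × X, κ p.1.1 p.1.2 * inner ℝ (a p.1.2 p.2) (b p.1.1 p.2) ∂((ν.prod ν).prod μ) =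
      ∫ q : α × X, inner ℝ (a q.1 q.2) (∫ τ, κ τ q.1 • b τ q.2 ∂ν) ∂(ν.prod μ) := by
  have hi := hκ.integrable_mul_inner ha hb
  have e := hκ.swap.integral_mul_inner_left hb ha
  have e' : ∫ q : α × X, inner ℝ (a q.1 q.2) (∫ τ, κ τ q.1 • b τ q.2 ∂ν) ∂(ν.prod μ) =
      ∫ q : α × X, inner ℝ (∫ τ, κ τ q.1 • b τ q.2 ∂ν) (a q.1 q.2) ∂(ν.prod μ) := by
    congr 1
    ext q
    rw [real_inner_comm]
  rw [e', ← e]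
  rw [← (measurePreserving_swap_prod_id ν μ).integral_comp_of_aestronglyMeasurable hi.1]
  congr 1
  ext p
  rw [real_inner_comm]

theorem integrable_mul_norm_sub_sq (hκ : IsSchurKernel ν κ) {g : α → X → F}
    (hg : MemLp (Function.uncurry g) 2 (ν.prod μ)) :
    Integrable (fun p : (α × α) × X => κ p.1.1 p.1.2 * ‖g p.1.1 p.2 - g p.1.2 p.2‖ ^ 2)
      ((ν.prod ν).prod μ) := by
  have hg2 := (memLp_two_iff_integrable_sq_norm hg.1).1 hg
  refine (((hκ.integrable_mul_fst (Y := fun t x => ‖g t x‖ ^ 2) hg2).add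
    (hκ.integrable_mul_snd (Y := fun t x => ‖g t x‖ ^ 2) hg2)).sub
    ((hκ.integrable_mul_inner hg hg).const_mul 2)).congr (Filter.Eventually.of_forall fun p => ?_)
  simp only [Pi.add_apply, Pi.sub_apply, norm_sub_sq_real, real_inner_comm]
  ring

/-- Polarization `2⟪a, b⟫ = |a|² + |b|² - |a - b|²` integrated against a Schur kernel. -/
theorem integral_mul_norm_sub_sq [CompleteSpace F] (hκ : IsSchurKernel ν κ) {g : α → X → F}
    (hg : MemLp (Function.uncurry g) 2 (ν.prod μ)) :
    ∫ p : (α × α) × X, κ p.1.1 p.1.2 * ‖g p.1.1 p.2 - g p.1.2 p.2‖ ^ 2 ∂((ν.prod ν).prod μ) =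
      (∫ q : α × X, (∫ τ, κ q.1 τ ∂ν) * ‖g q.1 q.2‖ ^ 2 ∂(ν.prod μ)) +
      (∫ q : α × X, (∫ τ, κ τ q.1 ∂ν) * ‖g q.1 q.2‖ ^ 2 ∂(ν.prod μ)) -
      2 * ∫ q : α × X, inner ℝ (g q.1 q.2) (∫ τ, κ τ q.1 • g τ q.2 ∂ν) ∂(ν.prod μ) := by
  have hg2 := (memLp_two_iff_integrable_sq_norm hg.1).1 hg
  have i1 := hκ.integrable_mul_fst (Y := fun t x => ‖g t x‖ ^ 2) hg2
  have i2 := hκ.integrable_mul_snd (Y := fun t x => ‖g t x‖ ^ 2) hg2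
  have i3 := hκ.integrable_mul_inner hg hg
  have e1 := hκ.integral_mul_fst (Y := fun t x => ‖g t x‖ ^ 2) hg2
  have e2 := hκ.swap.integral_mul_fst (Y := fun t x => ‖g t x‖ ^ 2) hg2
  have e3 := hκ.integral_mul_inner_right hg hg
  have e2' := (measurePreserving_swap_prod_id ν μ).integral_comp_of_aestronglyMeasurable i2.1
  rw [← e1, ← e2, e2', ← e3, ← integral_const_mul, ← integral_add i1 i2,
    ← integral_sub (Integrable.fun_add i1 i2) (i3.const_mul 2)]
  congr 1
  ext p
  simp only [norm_sub_sq_real, real_inner_comm]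
  ring

end IsSchurKernel

/-- The convolution kernel `(t, τ) ↦ a (t - τ)` on `(0, T)`, with `a` cut off to `(0, T)`. -/
noncomputable def convKernel (T : ℝ) (a : ℝ → ℝ) (t τ : ℝ) : ℝ :=
  (Ioo 0 T).indicator a (t - τ)

theorem isSchurKernel_convKernel {T : ℝ} {a : ℝ → ℝ} (ha : IntegrableOn a (Ioo 0 T)) :
    IsSchurKernel (volume.restrict (Ioo 0 T)) (convKernel T a) := by
  have hA := (integrable_indicator_iff measurableSet_Ioo).2 ha
  refine ⟨?_, ∫⁻ s, ‖(Ioo 0 T).indicator a s‖ₑ, hA.2.ne, fun t => ?_, fun τ => ?_⟩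
  · have := hA.1.comp_quasiMeasurePreserving
      (quasiMeasurePreserving_sub (volume : Measure ℝ) (volume : Measure ℝ))
    exact this.mono_measure (Measure.prod_mono Measure.restrict_le_self Measure.restrict_le_self)
  · refine (setLIntegral_le_lintegral _ _).trans_eq ?_
    exact lintegral_sub_left_eq_self (fun s => ‖(Ioo 0 T).indicator a s‖ₑ) t
  · refine (setLIntegral_le_lintegral _ _).trans_eq ?_
    exact lintegral_sub_right_eq_self (fun s => ‖(Ioo 0 T).indicator a s‖ₑ) τ

theorem integral_convKernel_smul {F : Type*} [NormedAddCommGroup F] [NormedSpace ℝ F] {T : ℝ}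
    (a : ℝ → ℝ) (v : ℝ → F) {t : ℝ} (ht : t ∈ Ioo 0 T) :
    ∫ τ in Ioo 0 T, convKernel T a t τ • v τ = timeConv a v t := by
  rw [timeConv_eq_setIntegral _ _ ht.1.le, ← integral_indicator measurableSet_Ioo,
    ← integral_indicator measurableSet_Ioo]
  congr 1
  ext τ
  simp only [convKernel, indicator, mem_Ioo]
  have h1 := ht.1
  have h2 := ht.2
  split_ifs <;> first | rfl | (exfalso; grind) | simp

theorem integral_convKernel_swap_smul {F : Type*} [NormedAddCommGroup F] [NormedSpace ℝ F] {T : ℝ}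
    (a : ℝ → ℝ) (v : ℝ → F) {t : ℝ} (ht : t ∈ Ioo 0 T) :
    ∫ τ in Ioo 0 T, convKernel T a τ t • v τ = dualConv T a v t := by
  rw [dualConv_eq_setIntegral _ _ ht.2.le, ← integral_indicator measurableSet_Ioo,
    ← integral_indicator measurableSet_Ioo]
  congr 1
  ext τ
  simp only [convKernel, indicator, mem_Ioo]
  have h1 := ht.1
  have h2 := ht.2
  split_ifs <;> first | rfl | (exfalso; grind) | simp

end SchurTest

/-! ### Positivity of the kernels -/

section ComparisonPrinciple

open scoped Convolution
open ContinuousLinearMap (lsmul)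

/-- The discrete form of `∂ₜ(k * V)(t₀) ≤ 0` at a point `t₀` where `V` attains a nonpositive
minimum over `[0, t₀]`; no differentiability of `k * V` is needed. -/
theorem timeConv_sub_timeConv_le {k V : ℝ → ℝ} {t₀ δ : ℝ} {C : NNReal} (hδ : 0 < δ) (hδt : δ < t₀)
    (hk : IntervalIntegrable k volume 0 t₀) (hk0 : ∀ t, 0 < t → 0 ≤ k t)
    (hka : AntitoneOn k (Ioi 0)) (hV : LipschitzWith C V) (hmin : ∀ s ∈ Icc 0 t₀, V t₀ ≤ V s)
    (hneg : V t₀ ≤ 0) :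
    timeConv k V t₀ - timeConv k V (t₀ - δ) ≤ C * δ * ∫ s in (0 : ℝ)..δ, k s := by
  set U : ℝ → ℝ := fun s => V s - V t₀ with hU
  have hUc : Continuous U := hV.continuous.sub continuous_const
  have hsub : ∀ {a b : ℝ}, a ∈ Icc 0 t₀ → b ∈ Icc 0 t₀ → IntervalIntegrable k volume a b :=
    fun ha hb => hk.mono_set (by
      rw [uIcc_of_le (hδ.trans hδt).le]
      exact uIcc_subset_Icc ha hb)
  have hkU : ∀ {a b : ℝ} (c : ℝ), a ∈ Icc 0 t₀ → b ∈ Icc 0 t₀ →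
      IntervalIntegrable (fun s => k s * U (c - s)) volume a b := fun c ha hb =>
    (hsub ha hb).mul_continuousOn (hUc.comp (continuous_const.sub continuous_id)).continuousOn
  have m0 : (0 : ℝ) ∈ Icc 0 t₀ := ⟨le_rfl, (hδ.trans hδt).le⟩
  have mt : t₀ ∈ Icc 0 t₀ := ⟨(hδ.trans hδt).le, le_rfl⟩
  have mδ : δ ∈ Icc 0 t₀ := ⟨hδ.le, hδt.le⟩
  have mtδ : t₀ - δ ∈ Icc 0 t₀ := ⟨by linarith, by linarith⟩
  have hdecomp : ∀ t ∈ Icc 0 t₀, timeConv k V t =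
      (∫ s in (0 : ℝ)..t, k s * U (t - s)) + V t₀ * ∫ s in (0 : ℝ)..t, k s := by
    intro t ht
    rw [timeConv_comm, timeConv, ← intervalIntegral.integral_const_mul,
      ← intervalIntegral.integral_add (hkU t m0 ht) ((hsub m0 ht).const_mul _)]
    refine intervalIntegral.integral_congr fun s _ => ?_
    simp only [hU, smul_eq_mul]
    ring
  -- Shifting by `δ` makes both convolutions integrals of `U (t₀ - ·) ≥ 0`, with the kernels `k` and
  -- `k (· - δ) ≥ k`.
  have hshift : ∫ s in (0 : ℝ)..(t₀ - δ), k s * U (t₀ - δ - s) =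
      ∫ s in δ..t₀, k (s - δ) * U (t₀ - s) := by
    have := intervalIntegral.integral_comp_sub_right (fun s => k s * U (t₀ - δ - s)) δ
      (a := δ) (b := t₀)
    rw [sub_self] at this
    rw [← this]
    refine intervalIntegral.integral_congr fun s _ => ?_
    congr 2
    ring
  have hshift_int : IntervalIntegrable (fun s => k (s - δ) * U (t₀ - s)) volume δ t₀ := by
    have h1 := (hsub m0 mtδ).comp_sub_right δ
    rw [zero_add, sub_add_cancel] at h1
    exact h1.mul_continuousOn (hUc.comp (continuous_const.sub continuous_id)).continuousOn
  have h1 : ∫ s in δ..t₀, k s * U (t₀ - s) ≤ ∫ s in δ..t₀, k (s - δ) * U (t₀ - s) := by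
    refine intervalIntegral.integral_mono_on_of_le_Ioo hδt.le (hkU t₀ mδ mt) hshift_int
      fun s hs => ?_
    have hUs : 0 ≤ U (t₀ - s) := sub_nonneg.2 (hmin _ ⟨by linarith [hs.2], by linarith [hs.1]⟩)
    refine mul_le_mul_of_nonneg_right (hka ?_ ?_ ?_) hUs
    · exact sub_pos.2 hs.1
    · exact hδ.trans hs.1
    · linarith
  have h2 : ∫ s in (0 : ℝ)..δ, k s * U (t₀ - s) ≤ C * δ * ∫ s in (0 : ℝ)..δ, k s := by
    rw [← intervalIntegral.integral_const_mul]
    refine intervalIntegral.integral_mono_on_of_le_Ioo hδ.le (hkU t₀ m0 mδ)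
      ((hsub m0 mδ).const_mul _) fun s hs => ?_
    have hUs : U (t₀ - s) ≤ C * δ := by
      have := hV.dist_le_mul (t₀ - s) t₀
      rw [Real.dist_eq, Real.dist_eq] at this
      have e : |t₀ - s - t₀| = s := by
        rw [abs_of_nonpos (by linarith [hs.1])]; ring
      rw [e] at this
      calc U (t₀ - s) ≤ |V (t₀ - s) - V t₀| := le_abs_self _
        _ ≤ C * s := this
        _ ≤ C * δ := by gcongr; exact hs.2.le
    rw [mul_comm]
    exact mul_le_mul_of_nonneg_right hUs (hk0 s hs.1)
  -- The constant part `V t₀ ≤ 0` contributes `V t₀` times a nonnegative integral.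
  have h3 : (∫ s in (0 : ℝ)..t₀, k s) - ∫ s in (0 : ℝ)..(t₀ - δ), k s =
      ∫ s in (t₀ - δ)..t₀, k s :=
    intervalIntegral.integral_interval_sub_left (hsub m0 mt) (hsub m0 mtδ)
  have h4 : 0 ≤ ∫ s in (t₀ - δ)..t₀, k s :=
    intervalIntegral.integral_nonneg (by linarith) fun s hs => hk0 s (by linarith [hs.1])
  rw [hdecomp t₀ mt, hdecomp _ mtδ, hshift,
    ← intervalIntegral.integral_add_adjacent_intervals (hkU t₀ m0 mδ) (hkU t₀ mδ mt)]
  nlinarith [mul_nonneg (neg_nonneg.2 hneg) h4]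

namespace IsPCPair

variable {k l : ℝ → ℝ}

theorem intervalIntegrable_k (hkl : IsPCPair k l) {t : ℝ} (ht : 0 ≤ t) :
    IntervalIntegrable k volume 0 t := by
  rw [intervalIntegrable_iff_integrableOn_Ioo_of_le ht]
  exact integrableOn_Ioo_of_locallyIntegrableOn hkl.locallyIntegrable_k t

theorem integral_k_pos (hkl : IsPCPair k l) {t : ℝ} (ht : 0 < t) : 0 < ∫ s in (0 : ℝ)..t, k s := by
  by_contra hc
  -- A nonnegative nonincreasing kernel with vanishing integral over `(0, t)` vanishes on `(0, ∞)`.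
  have h0 : ∀ s, 0 < s → k s = 0 := by
    by_contra! hne
    obtain ⟨s, hs, hks⟩ := hne
    have hpos : 0 < k s := lt_of_le_of_ne (hkl.nonneg_k s hs) hks.symm
    have hr : 0 < min s t := lt_min hs ht
    have h1 : ∫ _ in (0 : ℝ)..min s t, k s ≤ ∫ r in (0 : ℝ)..min s t, k r :=
      intervalIntegral.integral_mono_on_of_le_Ioo hr.le (by simp)
        (hkl.intervalIntegrable_k hr.le) fun r hr' =>
          hkl.antitone_k hr'.1 hs (hr'.2.le.trans (min_le_left _ _))
    have h2 : ∫ r in (0 : ℝ)..min s t, k r ≤ ∫ r in (0 : ℝ)..t, k r := by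
      refine intervalIntegral.integral_mono_interval le_rfl hr.le (min_le_right _ _) ?_
        (hkl.intervalIntegrable_k ht.le)
      filter_upwards [ae_restrict_mem measurableSet_Ioc] with r hr' using hkl.nonneg_k r hr'.1
    simp only [intervalIntegral.integral_const, sub_zero, smul_eq_mul] at h1
    have := mul_pos hr hpos
    linarith
  have h1 : ∀ t, 0 < t → timeConv k l t = 0 := by
    intro t ht
    rw [timeConv_eq_setIntegral _ _ ht.le]
    refine (setIntegral_congr_fun measurableSet_Ioo fun s hs => ?_).trans (integral_zero _ _)
    simp [h0 (t - s) (sub_pos.2 hs.2)]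
  have h2 : ∀ᵐ t ∂volume.restrict (Ioo (0 : ℝ) 1), False := by
    filter_upwards [ae_Ioo_of_Ioi hkl.conv_eq_one 1, ae_restrict_mem measurableSet_Ioo] with t e ht
    rw [h1 t ht.1] at e
    exact zero_ne_one e
  rw [Filter.eventually_false_iff_eq_bot, ae_eq_bot, Measure.restrict_eq_zero] at h2
  simp at h2

/-- `k * (l * g) = 1 * g` at every point, for bounded Lipschitz `g` vanishing on `(-∞, 0]`. -/
theorem exists_lipschitz_timeConv (hkl : IsPCPair k l) {g : ℝ → ℝ} {C : NNReal} {M : ℝ}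
    (hg : LipschitzWith C g) (hM : ∀ t, ‖g t‖ ≤ M) (hg0 : ∀ t ≤ 0, g t = 0) (T : ℝ) :
    ∃ (v : ℝ → ℝ) (C' : NNReal), LipschitzWith C' v ∧ v 0 = 0 ∧
      (∀ t ∈ Ioo 0 T, v t = timeConv l g t) ∧
      ∀ t ∈ Ioo 0 T, timeConv k v t = ∫ s in (0 : ℝ)..t, g s := by
  set K := (Ioo 0 T).indicator k with hK
  set L := (Ioo 0 T).indicator l with hL
  have hKi : Integrable K := (integrable_indicator_iff measurableSet_Ioo).2
    (integrableOn_Ioo_of_locallyIntegrableOn hkl.locallyIntegrable_k T)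
  have hLi : Integrable L := (integrable_indicator_iff measurableSet_Ioo).2
    (integrableOn_Ioo_of_locallyIntegrableOn hkl.locallyIntegrable_l T)
  have hint : ∀ t, Integrable fun s => L s * g (t - s) := fun t =>
    hLi.mul_bdd (c := M) (hg.continuous.comp (continuous_const.sub continuous_id)).aestronglyMeasurable
      (Filter.Eventually.of_forall fun s => hM _)
  have hbdd : BddAbove (range fun x => ‖‖g x‖‖) := ⟨M, by
    rintro _ ⟨x, rfl⟩
    simpa using hM x⟩
  have hv0 : ∀ t ≤ 0, (L ⋆[lsmul ℝ ℝ] g) t = 0 := fun t ht =>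
    convolution_eq_zero_of_nonpos (indicator_Ioo_of_nonpos l) hg0 ht
  refine ⟨L ⋆[lsmul ℝ ℝ] g, C * Real.toNNReal (∫ s, ‖L s‖), ?_, hv0 0 le_rfl, fun t ht => ?_,
    fun t ht => ?_⟩
  · refine LipschitzWith.of_dist_le_mul fun t t' => ?_
    rw [Real.dist_eq, NNReal.coe_mul, Real.coe_toNNReal _ (integral_nonneg fun s => norm_nonneg _)]
    simp only [convolution_def, ContinuousLinearMap.lsmul_apply, smul_eq_mul]
    rw [← integral_sub (hint t) (hint t'), ← Real.norm_eq_abs]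
    calc ‖∫ s, (L s * g (t - s) - L s * g (t' - s))‖
        ≤ ∫ s, ‖L s‖ * (C * dist t t') := by
          refine norm_integral_le_of_norm_le (hLi.norm.mul_const _)
            (Filter.Eventually.of_forall fun s => ?_)
          rw [← mul_sub, norm_mul]
          gcongr
          have := hg.dist_le_mul (t - s) (t' - s)
          rwa [dist_sub_right, Real.dist_eq, ← Real.norm_eq_abs] at this
      _ = C * (∫ s, ‖L s‖) * dist t t' := by
          rw [integral_mul_const]; ring
  · exact (timeConv_eq_convolution ht.1.le (eqOn_indicator_Ioo ht.2.le l) (fun _ _ => rfl)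
      (indicator_Ioo_of_nonpos l) hg0).symm
  · have hexists : ∀ x, ConvolutionExistsAt (fun x => ‖L x‖) (fun x => ‖g x‖) x
        (ContinuousLinearMap.mul ℝ ℝ) volume := fun x =>
      (hint x).norm.congr (Filter.Eventually.of_forall fun s => by simp)
    have hcont : Continuous ((fun x => ‖L x‖) ⋆[ContinuousLinearMap.mul ℝ ℝ] fun x => ‖g x‖) :=
      hbdd.continuous_convolution_right_of_integrable _ hLi.norm hg.continuous.norm
    have hbound : ∀ x, ‖((fun x => ‖L x‖) ⋆[ContinuousLinearMap.mul ℝ ℝ] fun x => ‖g x‖) x‖ ≤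
        (∫ s, ‖L s‖) * M := by
      intro x
      rw [convolution_def, ← integral_mul_const]
      refine norm_integral_le_of_norm_le (hLi.norm.mul_const _)
        (Filter.Eventually.of_forall fun s => ?_)
      simp only [ContinuousLinearMap.mul_apply', norm_mul, norm_norm]
      gcongr
      exact hM _
    have hassoc := convolution_assoc (lsmul ℝ ℝ) (lsmul ℝ ℝ) (lsmul ℝ ℝ) (lsmul ℝ ℝ) (x₀ := t)
      (fun x y z => by simp [mul_assoc]) hKi.1 hLi.1 hg.continuous.aestronglyMeasurable
      (hKi.ae_convolution_exists (lsmul ℝ ℝ) hLi)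
      (Filter.Eventually.of_forall hexists)
      (BddAbove.convolutionExistsAt (s := univ) (ContinuousLinearMap.mul ℝ ℝ)
        ⟨(∫ s, ‖L s‖) * M, by
          rintro _ ⟨x, -, rfl⟩
          exact hbound x⟩
        MeasurableSet.univ (subset_univ _) hKi.norm.integrableOn hcont.aestronglyMeasurable)
    have hsub : ∀ s ∈ Ioo 0 t, s ∈ Icc 0 T := fun s hs => ⟨hs.1.le, (hs.2.trans ht.2).le⟩
    rw [timeConv_eq_convolution (A := K) (V := L ⋆[lsmul ℝ ℝ] g) ht.1.le
        (eqOn_indicator_Ioo ht.2.le k) (fun _ _ => rfl) (indicator_Ioo_of_nonpos k) hv0, ← hassoc,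
      ← timeConv_eq_convolution (a := timeConv k l) (v := g) ht.1.le
        (fun s hs => (timeConv_eq_convolution_indicator (hsub s hs) k l).symm) (fun _ _ => rfl)
        (fun s hs => convolution_eq_zero_of_nonpos (indicator_Ioo_of_nonpos k)
          (indicator_Ioo_of_nonpos l) hs) hg0,
      timeConv_congr_ae (Ioo_subset_Icc_self ht) (ae_Ioo_of_Ioi hkl.conv_eq_one T)
        Filter.EventuallyEq.rfl, timeConv_one_left]

/-- Comparison principle: `l * g ≥ 0` for `g ≥ 0`. The barrier `ε t` makes `∂ₜ(k * (v + ε t))`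
strictly positive even where `k` vanishes. -/
theorem timeConv_nonneg (hkl : IsPCPair k l) {g : ℝ → ℝ} {C : NNReal} {M : ℝ}
    (hg : LipschitzWith C g) (hM : ∀ t, ‖g t‖ ≤ M) (hg0 : ∀ t ≤ 0, g t = 0) (hgn : ∀ t, 0 ≤ g t)
    {t : ℝ} (ht : 0 < t) : 0 ≤ timeConv l g t := by
  obtain ⟨v, C', hv, hv0, hvl, hkv⟩ := hkl.exists_lipschitz_timeConv hg hM hg0 (t + 1)
  rw [← hvl t ⟨ht, lt_add_one t⟩]
  by_contra! hneg
  -- With this `ε` the value `v t + ε t = v t / 2` is still negative.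
  set ε : ℝ := -v t / (2 * t) with hε
  have hεpos : 0 < ε := div_pos (neg_pos.2 hneg) (by positivity)
  set V : ℝ → ℝ := fun s => v s + ε * s with hVdef
  have hVL : LipschitzWith (C' + Real.toNNReal ε) V := by
    refine LipschitzWith.of_dist_le_mul fun a b => ?_
    have h1 := hv.dist_le_mul a b
    rw [NNReal.coe_add, Real.coe_toNNReal _ hεpos.le, add_mul]
    refine (dist_add_add_le _ _ _ _).trans (add_le_add h1 ?_)
    rw [Real.dist_eq, Real.dist_eq, ← mul_sub, abs_mul, abs_of_pos hεpos]
  obtain ⟨t₀, ht₀, hmin⟩ := isCompact_Icc.exists_isMinOn (nonempty_Icc.2 ht.le)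
    hVL.continuous.continuousOn
  have hVt : V t < 0 := by
    have : ε * t = -v t / 2 := by rw [hε]; field_simp
    simp only [hVdef, this]
    linarith
  have hVt₀ : V t₀ < 0 := (hmin (right_mem_Icc.2 ht.le)).trans_lt hVt
  have ht₀pos : 0 < t₀ := by
    refine lt_of_le_of_ne ht₀.1 fun h => ?_
    rw [← h] at hVt₀
    simp [hVdef, hv0] at hVt₀
  have hki : ∀ {a b : ℝ}, 0 ≤ a → 0 ≤ b → IntervalIntegrable k volume a b := fun ha hb =>
    (hkl.intervalIntegrable_k ha).symm.trans (hkl.intervalIntegrable_k hb)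
  have hVeq : ∀ s ∈ Ioc 0 t, timeConv k V s =
      (∫ r in (0 : ℝ)..s, g r) + ε * ∫ r in (0 : ℝ)..s, k r * (s - r) := by
    intro s hs
    rw [← hkv s ⟨hs.1, by linarith [hs.2]⟩, timeConv_comm k V, timeConv_comm k v, timeConv, timeConv,
      ← intervalIntegral.integral_const_mul, ← intervalIntegral.integral_add]
    · refine intervalIntegral.integral_congr fun r _ => ?_
      simp only [hVdef, smul_eq_mul]
      ring
    · simp only [smul_eq_mul]
      exact (hki le_rfl hs.1.le).continuousOn_mul
        (hv.continuous.comp (continuous_const.sub continuous_id)).continuousOn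
    · exact ((hki le_rfl hs.1.le).mul_continuousOn (by fun_prop)).const_mul _
  have hgi : ∀ a b, IntervalIntegrable g volume a b := fun a b => hg.continuous.intervalIntegrable a b
  -- Compare both bounds for the increment of `k * V` over `[t₀ - δ, t₀]`, divided by `δ`.
  have key : ∀ δ ∈ Ioo 0 (t₀ / 2), ε * ∫ r in (0 : ℝ)..(t₀ / 2), k r ≤
      (C' + ε) * ∫ r in (0 : ℝ)..δ, k r := by
    intro δ hδ
    have hδ1 := hδ.1
    have hδ2 := hδ.2
    have h1 := timeConv_sub_timeConv_le hδ.1 (by linarith) (hki le_rfl ht₀pos.le) hkl.nonneg_k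
      hkl.antitone_k hVL (fun s hs => hmin ⟨hs.1, hs.2.trans ht₀.2⟩) hVt₀.le
    rw [hVeq t₀ ⟨ht₀pos, ht₀.2⟩, hVeq (t₀ - δ) ⟨by linarith, by linarith [ht₀.2]⟩, NNReal.coe_add,
      Real.coe_toNNReal _ hεpos.le] at h1
    have h2 : ∫ r in (0 : ℝ)..(t₀ - δ), g r ≤ ∫ r in (0 : ℝ)..t₀, g r :=
      intervalIntegral.integral_mono_interval le_rfl (by linarith) (by linarith)
        (Filter.Eventually.of_forall hgn) (hgi _ _)
    have h3 : δ * (∫ r in (0 : ℝ)..(t₀ / 2), k r) ≤ (∫ r in (0 : ℝ)..t₀, k r * (t₀ - r)) -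
        ∫ r in (0 : ℝ)..(t₀ - δ), k r * (t₀ - δ - r) := by
      have i1 : ∀ {a b : ℝ} (c : ℝ), 0 ≤ a → 0 ≤ b →
          IntervalIntegrable (fun r => k r * (c - r)) volume a b := fun c ha hb =>
        (hki ha hb).mul_continuousOn (by fun_prop)
      rw [← intervalIntegral.integral_add_adjacent_intervals
        (i1 t₀ le_rfl (by linarith : 0 ≤ t₀ - δ)) (i1 t₀ (by linarith) ht₀pos.le), add_sub_right_comm,
        ← intervalIntegral.integral_sub (i1 _ le_rfl (by linarith)) (i1 _ le_rfl (by linarith))]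
      have e1 : ∫ r in (0 : ℝ)..(t₀ - δ), (k r * (t₀ - r) - k r * (t₀ - δ - r)) =
          δ * ∫ r in (0 : ℝ)..(t₀ - δ), k r := by
        rw [← intervalIntegral.integral_const_mul]
        refine intervalIntegral.integral_congr fun r _ => ?_
        ring
      have e2 : ∫ r in (0 : ℝ)..(t₀ / 2), k r ≤ ∫ r in (0 : ℝ)..(t₀ - δ), k r := by
        refine intervalIntegral.integral_mono_interval le_rfl (by linarith) (by linarith) ?_
          (hki le_rfl (by linarith))
        filter_upwards [ae_restrict_mem measurableSet_Ioc] with r hr using hkl.nonneg_k r hr.1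
      have e3 : 0 ≤ ∫ r in (t₀ - δ)..t₀, k r * (t₀ - r) :=
        intervalIntegral.integral_nonneg (by linarith) fun r hr =>
          mul_nonneg (hkl.nonneg_k r (by linarith [hr.1])) (by linarith [hr.2])
      rw [e1]
      have := mul_le_mul_of_nonneg_left e2 hδ.1.le
      linarith
    have h4 := mul_le_mul_of_nonneg_left h3 hεpos.le
    have h5 : δ * (ε * ∫ r in (0 : ℝ)..(t₀ / 2), k r) ≤ δ * ((C' + ε) * ∫ r in (0 : ℝ)..δ, k r) := by
      nlinarith
    exact le_of_mul_le_mul_left h5 hδ.1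
  have hlim : Filter.Tendsto (fun δ => (C' + ε) * ∫ r in (0 : ℝ)..δ, k r) (nhdsWithin 0 (Ioi 0))
      (nhds ((C' + ε) * ∫ r in (0 : ℝ)..0, k r)) := by
    refine Filter.Tendsto.const_mul _ ?_
    have hc := intervalIntegral.continuousOn_primitive_interval (a := 0) (b := 1) (f := k) (μ := volume)
      ((intervalIntegrable_iff_integrableOn_Icc_of_le zero_le_one).1
        (hki le_rfl zero_le_one) |>.congr_set_ae (by rw [uIcc_of_le zero_le_one]; exact Filter.EventuallyEq.rfl))
    have h0 := hc 0 left_mem_uIcc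
    refine h0.mono_left (nhdsWithin_le_iff.2 ?_)
    rw [uIcc_of_le zero_le_one]
    exact Icc_mem_nhdsGT zero_lt_one
  rw [intervalIntegral.integral_same, mul_zero] at hlim
  have := ge_of_tendsto hlim (Filter.eventually_of_mem (Ioo_mem_nhdsGT (half_pos ht₀pos)) key)
  have := mul_pos hεpos (hkl.integral_k_pos (half_pos ht₀pos))
  linarith

/-- If `(k, l)` is a pair of type `PC`, then `l ≥ 0`: mollifications of `l` are values of `l * g`
with bump functions `g`, to which the comparison principle applies. -/
theorem nonneg_l (hkl : IsPCPair k l) : ∀ᵐ t ∂volume.restrict (Ioi (0 : ℝ)), 0 ≤ l t := by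
  refine ae_Ioi_of_forall_Ioo fun T => ?_
  set L := (Ioo 0 T).indicator l with hL
  have hLi : Integrable L := (integrable_indicator_iff measurableSet_Ioo).2
    (integrableOn_Ioo_of_locallyIntegrableOn hkl.locallyIntegrable_l T)
  let φ : ℕ → ContDiffBump (0 : ℝ) := fun i =>
    ⟨1 / (i + 1 : ℝ) / 2, 1 / (i + 1 : ℝ), by positivity, half_lt_self (by positivity)⟩
  have hφ : Filter.Tendsto (fun i => (φ i).rOut) Filter.atTop (nhds 0) :=
    tendsto_one_div_add_atTop_nhds_zero_nat
  have hconv := ContDiffBump.ae_convolution_tendsto_right_of_locallyIntegrable (φ := φ) (K := 2) hφ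
    (Filter.Eventually.of_forall fun i => by simp only [φ]; linarith) hLi.locallyIntegrable
    (μ := volume)
  rw [ae_restrict_iff' measurableSet_Ioo]
  filter_upwards [hconv] with t ht htT
  rw [hL, indicator_of_mem htT] at ht
  refine ge_of_tendsto ht ?_
  filter_upwards [hφ.eventually (gt_mem_nhds (sub_pos.2 htT.2))] with i hi
  set r := (φ i).rOut with hr
  have hrpos : 0 < r := (φ i).rOut_pos
  -- The bump function is shifted by its radius so that it vanishes on `(-∞, 0]`.
  set g : ℝ → ℝ := fun s => (φ i).normed volume (s - r) with hg
  have hcd : ContDiff ℝ 1 ((φ i).normed volume) := (φ i).contDiff_normed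
  obtain ⟨C, hC⟩ := hcd.lipschitzWith_of_hasCompactSupport (φ i).hasCompactSupport_normed one_ne_zero
  obtain ⟨M, hM⟩ := hC.continuous.norm.bddAbove_range_of_hasCompactSupport
    (φ i).hasCompactSupport_normed.norm
  have hgC : LipschitzWith C g := by
    refine LipschitzWith.of_dist_le_mul fun a b => ?_
    have := hC.dist_le_mul (a - r) (b - r)
    rwa [dist_sub_right] at this
  have hg0 : ∀ s ≤ 0, g s = 0 := by
    intro s hs
    have : s - r ∉ Function.support ((φ i).normed volume) := by
      rw [(φ i).support_normed_eq, mem_ball_zero_iff, not_lt, Real.norm_eq_abs,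
        abs_of_neg (by linarith)]
      linarith
    exact Function.notMem_support.1 this
  have hnn := hkl.timeConv_nonneg hgC (M := M) (fun s => hM ⟨s - r, rfl⟩) hg0
    (fun s => (φ i).nonneg_normed _) (t := t + r) (by linarith [htT.1])
  rw [timeConv_eq_convolution (A := L) (V := g) (by linarith [htT.1])
    (eqOn_indicator_Ioo (by linarith) l) (fun _ _ => rfl) (indicator_Ioo_of_nonpos l) hg0] at hnn
  have e : ((φ i).normed volume ⋆[lsmul ℝ ℝ] L) t = (L ⋆[lsmul ℝ ℝ] g) (t + r) := by
    rw [convolution_lsmul_swap, convolution_def]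
    congr 1
    ext s
    simp only [ContinuousLinearMap.lsmul_apply, smul_eq_mul, hg]
    rw [mul_comm]
    congr 2
    ring
  rw [e]
  exact hnn

end IsPCPair

/-- The resolvent kernel belongs to the kernel `k + γ`: `(k + γ, h_γ / γ)` is again a pair of type
`PC`. -/
theorem IsPCPair.add_const {k l h : ℝ → ℝ} {γ : ℝ} (hkl : IsPCPair k l)
    (hh : IsResolventKernel γ l h) (hγ : 0 < γ) : IsPCPair (fun t => k t + γ) fun t => h t / γ where
  locallyIntegrable_k := hkl.locallyIntegrable_k.add (locallyIntegrableOn_const γ)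
  nonneg_k t ht := add_nonneg (hkl.nonneg_k t ht) hγ.le
  antitone_k := hkl.antitone_k.add_const γ
  locallyIntegrable_l := by
    simpa only [div_eq_inv_mul, smul_eq_mul] using! hh.1.smul γ⁻¹
  conv_eq_one := by
    refine ae_Ioi_of_forall_Ioo fun T => ?_
    have hk := integrableOn_Ioo_of_locallyIntegrableOn hkl.locallyIntegrable_k T
    have hi := integrableOn_Ioo_of_locallyIntegrableOn hh.1 T
    have h1 : IntegrableOn (fun _ => (1 : ℝ)) (Ioo 0 T) := by simp
    filter_upwards [timeConv_smul_sub_smul_left hk h1 hi γ⁻¹ (-1),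
      ae_Ioo_of_Ioi (hh.timeConv_eq hkl) T] with t e1 e2
    have e3 : timeConv (fun t => k t + γ) (fun t => h t / γ) t =
        timeConv (fun s => γ⁻¹ * k s - -1 * 1) h t := by
      simp only [timeConv, smul_eq_mul]
      refine intervalIntegral.integral_congr fun s _ => ?_
      field_simp
      ring
    rw [e3, e1, e2, timeConv_one_left, smul_eq_mul, smul_eq_mul]
    field_simp
    ring

theorem IsResolventKernel.nonneg {k l h : ℝ → ℝ} {γ : ℝ} (hkl : IsPCPair k l)
    (hh : IsResolventKernel γ l h) (hγ : 0 < γ) :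
    ∀ᵐ t ∂volume.restrict (Ioi (0 : ℝ)), 0 ≤ h t := by
  filter_upwards [(hkl.add_const hh hγ).nonneg_l] with t ht
  simpa [hγ.ne'] using mul_nonneg ht hγ.le

end ComparisonPrinciple

/-! ### Weak derivatives in time -/

section WeakDerivatives

theorem integral_primitive_mul_deriv {d φ : ℝ → ℝ} {T : ℝ} (hT : 0 ≤ T)
    (hd : IntegrableOn d (Ioo 0 T)) (hφ : ContDiff ℝ 1 φ) (hφT : φ T = 0) :
    ∫ t in Ioo 0 T, (∫ τ in (0 : ℝ)..t, d τ) * deriv φ t = -∫ t in Ioo 0 T, d t * φ t := by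
  have hdi : IntervalIntegrable d volume 0 T :=
    (intervalIntegrable_iff_integrableOn_Ioo_of_le hT).2 hd
  have hac := hdi.absolutelyContinuousOnInterval_intervalIntegral (c := 0) left_mem_uIcc
  have h := hac.integral_mul_deriv_eq_deriv_mul hφ.contDiffOn.absolutelyContinuousOnInterval
  simp only [hφT, intervalIntegral.integral_same, mul_zero, zero_mul, sub_self, zero_sub] at h
  rw [← integral_Ioc_eq_integral_Ioo, ← integral_Ioc_eq_integral_Ioo,
    ← intervalIntegral.integral_of_le hT, ← intervalIntegral.integral_of_le hT, h]
  congr 1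
  refine intervalIntegral.integral_congr_ae ?_
  filter_upwards [hdi.ae_hasDerivAt_integral] with t ht hmem
  rw [(ht (uIoc_subset_uIcc hmem) 0 left_mem_uIcc).deriv]

theorem HasWeakDerivOn.ae_eq {V : Type*} [NormedAddCommGroup V] [NormedSpace ℝ V]
    [FiniteDimensional ℝ V] [MeasureSpace V] [BorelSpace V] {U : Set V} (hU : IsOpen U) {e : V}
    {v g g' : V → ℝ} (hg : HasWeakDerivOn U e v g) (hg' : HasWeakDerivOn U e v g') :
    g =ᵐ[volume.restrict U] g' := by
  have h : ∀ᵐ x, x ∈ U → g x - g' x = 0 := by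
    refine hU.ae_eq_zero_of_integral_contDiff_smul_eq_zero (hg.2.1.sub hg'.2.1)
      fun φ h1 h2 h3 => ?_
    have hint : ∀ {f : V → ℝ}, LocallyIntegrableOn f U → IntegrableOn (fun x => f x * φ x) U := by
      intro f hf
      have hK : IntegrableOn f (tsupport φ) := hf.integrableOn_compact_subset h3 h2.isCompact
      obtain ⟨M, hM⟩ := h1.continuous.norm.bddAbove_range_of_hasCompactSupport h2.norm
      have := Integrable.mul_bdd (c := M) hK h1.continuous.aestronglyMeasurable
        (Filter.Eventually.of_forall fun x => hM ⟨x, rfl⟩)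
      refine IntegrableOn.of_forall_sdiff_eq_zero this hU.measurableSet fun x hx => ?_
      rw [image_eq_zero_of_notMem_tsupport hx.2, mul_zero]
    have e1 := hg.2.2 φ ⟨h1, h2, h3⟩
    have e2 := hg'.2.2 φ ⟨h1, h2, h3⟩
    have e3 : ∫ x in U, φ x • (g x - g' x) = ∫ x, φ x • (g x - g' x) :=
      setIntegral_eq_integral_of_forall_compl_eq_zero fun x hx => by
        rw [image_eq_zero_of_notMem_tsupport (fun h => hx (h3 h)), zero_smul]
    have e4 : ∫ x in U, φ x • (g x - g' x) = ∫ x in U, (g x * φ x - g' x * φ x) := by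
      congr 1
      ext x
      simp only [smul_eq_mul]
      ring
    rw [← e3, e4, integral_sub (hint hg.2.1) (hint hg'.2.1)]
    linarith
  rw [Filter.EventuallyEq, ae_restrict_iff' hU.measurableSet]
  filter_upwards [h] with x hx hxU using sub_eq_zero.1 (hx hxU)

/-- The weak derivative of `k_γ = γ - γ (1 * h_γ)` is `-γ h_γ`. -/
theorem IsResolventKernel.hasWeakDerivOn {k l h : ℝ → ℝ} {γ : ℝ} (hkl : IsPCPair k l)
    (hh : IsResolventKernel γ l h) :
    HasWeakDerivOn (Ioi 0) 1 (timeConv k h) fun s => -γ * h s := by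
  have hT : ∀ K ⊆ Ioi (0 : ℝ), IsCompact K → ∃ T, 0 ≤ T ∧ K ⊆ Ioo 0 T := by
    intro K hK hKc
    obtain ⟨M, hM⟩ := hKc.bddAbove
    exact ⟨max 0 (M + 1), le_max_left _ _, fun t ht => ⟨hK ht, (hM ht).trans_lt
      ((lt_add_one M).trans_le (le_max_right _ _))⟩⟩
  refine ⟨?_, ?_, fun φ hφ => ?_⟩
  · rw [locallyIntegrableOn_iff isOpen_Ioi.isLocallyClosed]
    intro K hK hKc
    obtain ⟨T, -, hKT⟩ := hT K hK hKc
    exact (integrableOn_timeConv (integrableOn_Ioo_of_locallyIntegrableOn hkl.locallyIntegrable_k T)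
      (integrableOn_Ioo_of_locallyIntegrableOn hh.1 T)).mono_set hKT
  · exact (hh.1.mono_set Ioi_subset_Ici_self).smul (-γ)
  · obtain ⟨T, hT0, hKT⟩ := hT _ hφ.2.2 hφ.2.1.isCompact
    have hd : IntegrableOn (fun s => -γ * h s) (Ioo 0 T) :=
      Integrable.const_mul (integrableOn_Ioo_of_locallyIntegrableOn hh.1 T) (-γ)
    have hφ1 : ContDiff ℝ 1 φ := hφ.1.of_le (by norm_cast)
    have hz : ∀ t ∉ Ioo 0 T, φ t = 0 := fun t ht =>
      image_eq_zero_of_notMem_tsupport fun h => ht (hKT h)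
    have hz' : ∀ t ∉ Ioo 0 T, deriv φ t = 0 := fun t ht =>
      image_eq_zero_of_notMem_tsupport fun h => ht (hKT (tsupport_deriv_subset h))
    have hIoi : ∀ F : ℝ → ℝ, (∀ t ∉ Ioo 0 T, F t = 0) → ∫ t in Ioi 0, F t = ∫ t in Ioo 0 T, F t :=
      fun F hF => setIntegral_eq_of_subset_of_forall_sdiff_eq_zero measurableSet_Ioi
        Ioo_subset_Ioi_self fun t ht => hF t ht.2
    simp only [fderiv_apply_one_eq_deriv]
    rw [hIoi _ fun t ht => by rw [hz' t ht, mul_zero], hIoi _ fun t ht => by rw [hz t ht, mul_zero],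
      ← integral_primitive_mul_deriv hT0 hd hφ1 (hz T (by simp))]
    have hdi : IntervalIntegrable (fun s => -γ * h s) volume 0 T :=
      (intervalIntegrable_iff_integrableOn_Ioo_of_le hT0).2 hd
    have hP : ContinuousOn (fun t => ∫ τ in (0 : ℝ)..t, -γ * h τ) (Icc 0 T) := by
      have := intervalIntegral.continuousOn_primitive_interval' hdi left_mem_uIcc
      rwa [uIcc_of_le hT0] at this
    have hφ' : Continuous (deriv φ) := hφ1.continuous_deriv le_rfl
    have hPi : IntegrableOn (fun t => (∫ τ in (0 : ℝ)..t, -γ * h τ) * deriv φ t) (Ioo 0 T) :=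
      ((hP.mul hφ'.continuousOn).integrableOn_compact isCompact_Icc).mono_set Ioo_subset_Icc_self
    have hγi : IntegrableOn (fun t => γ * deriv φ t) (Ioo 0 T) :=
      ((continuous_const.mul hφ').continuousOn.integrableOn_compact isCompact_Icc).mono_set
        Ioo_subset_Icc_self
    have hγ0 : ∫ t in Ioo 0 T, γ * deriv φ t = 0 := by
      rw [integral_const_mul, ← integral_Ioc_eq_integral_Ioo, ← intervalIntegral.integral_of_le hT0,
        intervalIntegral.integral_deriv_eq_sub (fun t _ => hφ1.differentiable one_ne_zero t)
          (hφ'.intervalIntegrable _ _),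
        hz T (by simp), hz 0 (by simp), sub_self, mul_zero]
    have hadd := integral_add hPi hγi
    rw [hγ0, add_zero] at hadd
    rw [← hadd]
    refine integral_congr_ae ?_
    filter_upwards [ae_Ioo_of_Ioi (hh.timeConv_eq hkl) T] with t ht
    rw [ht, intervalIntegral.integral_const_mul]
    ring

theorem volume_restrict_cylinder {N : ℕ} (T : ℝ) (Ω : Set (EuclideanSpace ℝ (Fin N))) :
    (volume : Measure (ℝ × EuclideanSpace ℝ (Fin N))).restrict (Ioo 0 T ×ˢ Ω) =
      (volume.restrict (Ioo 0 T)).prod (volume.restrict Ω) := by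
  rw [Measure.volume_eq_prod, Measure.prod_restrict]

/-- A function on a cylinder whose time slices are primitives of the time slices of `d` has the
weak time derivative `d`. -/
theorem hasWeakDerivOn_cylinder {N : ℕ} {T : ℝ} (hT : 0 ≤ T) {Ω : Set (EuclideanSpace ℝ (Fin N))}
    {P d : ℝ → EuclideanSpace ℝ (Fin N) → ℝ}
    (hP : Integrable (Function.uncurry P) ((volume.restrict (Ioo 0 T)).prod (volume.restrict Ω)))
    (hd : Integrable (Function.uncurry d) ((volume.restrict (Ioo 0 T)).prod (volume.restrict Ω)))
    (hPd : ∀ᵐ x ∂volume.restrict Ω, ∀ᵐ t ∂volume.restrict (Ioo 0 T),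
      P t x = ∫ τ in (0 : ℝ)..t, d τ x) :
    HasWeakDerivOn (Ioo 0 T ×ˢ Ω) ((1 : ℝ), (0 : EuclideanSpace ℝ (Fin N)))
      (Function.uncurry P) (Function.uncurry d) := by
  refine ⟨?_, ?_, fun φ hφ => ?_⟩
  · refine IntegrableOn.locallyIntegrableOn ?_
    rwa [IntegrableOn, volume_restrict_cylinder]
  · refine IntegrableOn.locallyIntegrableOn ?_
    rwa [IntegrableOn, volume_restrict_cylinder]
  have hφ1 : ContDiff ℝ 1 φ := hφ.1.of_le (by norm_cast)
  have hφ'c : Continuous fun p => fderiv ℝ φ p ((1 : ℝ), (0 : EuclideanSpace ℝ (Fin N))) :=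
    (hφ1.continuous_fderiv one_ne_zero).clm_apply continuous_const
  have hφ's : HasCompactSupport fun p => fderiv ℝ φ p ((1 : ℝ), (0 : EuclideanSpace ℝ (Fin N))) :=
    hφ.2.1.fderiv_apply ℝ _
  obtain ⟨M, hM⟩ := hφ.1.continuous.norm.bddAbove_range_of_hasCompactSupport hφ.2.1.norm
  obtain ⟨M', hM'⟩ := hφ'c.norm.bddAbove_range_of_hasCompactSupport hφ's.norm
  have h1 := hP.mul_bdd (c := M') hφ'c.aestronglyMeasurable
    (Filter.Eventually.of_forall fun p => hM' ⟨p, rfl⟩)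
  have h2 := hd.mul_bdd (c := M) hφ.1.continuous.aestronglyMeasurable
    (Filter.Eventually.of_forall fun p => hM ⟨p, rfl⟩)
  rw [volume_restrict_cylinder, integral_prod_symm _ h1, integral_prod_symm _ h2, ← integral_neg]
  refine integral_congr_ae ?_
  filter_upwards [hPd, hd.prod_left_ae] with x hx hdx
  have hline : ∀ t : ℝ, HasDerivAt (fun s => φ (s, x))
      (fderiv ℝ φ (t, x) ((1 : ℝ), (0 : EuclideanSpace ℝ (Fin N)))) t := by
    intro t
    have hd1 : HasDerivAt (fun s : ℝ => (s, x)) ((1 : ℝ), (0 : EuclideanSpace ℝ (Fin N))) t :=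
      (hasDerivAt_id t).prodMk (hasDerivAt_const t x)
    exact (hφ1.differentiable one_ne_zero (t, x)).hasFDerivAt.comp_hasDerivAt t hd1
  have hT0 : φ (T, x) = 0 := image_eq_zero_of_notMem_tsupport fun h =>
    absurd (hφ.2.2 h).1.2 (lt_irrefl _)
  have hslice : ContDiff ℝ 1 fun s : ℝ => φ (s, x) := hφ1.comp (contDiff_id.prodMk contDiff_const)
  have := integral_primitive_mul_deriv (d := fun t => d t x) hT hdx hslice hT0
  rw [show (-∫ t in Ioo 0 T, Function.uncurry d (t, x) * φ (t, x)) =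
    -∫ t in Ioo 0 T, d t x * φ (t, x) from rfl, ← this]
  refine integral_congr_ae ?_
  filter_upwards [hx] with t ht
  rw [(hline t).deriv, ← ht]
  rfl

end WeakDerivatives

/-! ### Convolutions on a cylinder -/

section Cylinder

variable {X : Type*} [MeasurableSpace X] {μ : Measure X} [SFinite μ]
  {F : Type*} [NormedAddCommGroup F] [InnerProductSpace ℝ F] {T : ℝ}

theorem MeasureTheory.MemLp.integrable_inner {β : Type*} [MeasurableSpace β] {m : Measure β}
    {a b : β → F} (ha : MemLp a 2 m) (hb : MemLp b 2 m) :
    Integrable (fun x => inner ℝ (a x) (b x)) m := by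
  refine ((MemLp.integrable_mul ha.norm hb.norm)).mono' (ha.1.inner hb.1)
    (Filter.Eventually.of_forall fun x => ?_)
  simpa using abs_real_inner_le_norm (a x) (b x)

theorem ae_fst_mem_Ioo (T : ℝ) (μ : Measure X) :
    ∀ᵐ q : ℝ × X ∂((volume.restrict (Ioo 0 T)).prod μ), q.1 ∈ Ioo 0 T :=
  Measure.quasiMeasurePreserving_fst.ae (ae_restrict_mem measurableSet_Ioo)

/-- Two measurable functions that agree on almost every slice agree almost everywhere. The
measurability makes the exceptional set null-measurable, as Fubini's theorem requires. -/
theorem ae_prod_eq_of_slices {α E : Type*} [MeasurableSpace α] {ν : Measure α} [SFinite ν]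
    [TopologicalSpace E] [TopologicalSpace.MetrizableSpace E] {P Q : α → X → E}
    (hP : AEStronglyMeasurable (Function.uncurry P) (ν.prod μ))
    (hQ : AEStronglyMeasurable (Function.uncurry Q) (ν.prod μ))
    (h : ∀ᵐ x ∂μ, ∀ᵐ t ∂ν, P t x = Q t x) :
    Function.uncurry P =ᵐ[ν.prod μ] Function.uncurry Q := by
  have h1 := Measure.ae_ae_of_ae_prod (hP.prod_swap.ae_eq_mk)
  have h2 := Measure.ae_ae_of_ae_prod (hQ.prod_swap.ae_eq_mk)
  have hmeas : MeasurableSet {z : X × α | hP.prod_swap.mk _ z = hQ.prod_swap.mk _ z} :=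
    hP.prod_swap.stronglyMeasurable_mk.measurableSet_eq_fun hQ.prod_swap.stronglyMeasurable_mk
  have h3 : ∀ᵐ z ∂(μ.prod ν), hP.prod_swap.mk _ z = hQ.prod_swap.mk _ z := by
    refine (Measure.ae_prod_iff_ae_ae hmeas).2 ?_
    filter_upwards [h1, h2, h] with x e1 e2 e3
    filter_upwards [e1, e2, e3] with t f1 f2 f3
    rw [← f1, ← f2]
    exact f3
  have h4 : ∀ᵐ z : X × α ∂(μ.prod ν), P z.2 z.1 = Q z.2 z.1 := by
    filter_upwards [hP.prod_swap.ae_eq_mk, hQ.prod_swap.ae_eq_mk, h3] with z e1 e2 e3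
    exact e1.trans (e3.trans e2.symm)
  exact (Measure.measurePreserving_swap (μ := ν) (ν := μ)).quasiMeasurePreserving.ae h4

omit [InnerProductSpace ℝ F] in
theorem ae_memLp_slice {α : Type*} [MeasurableSpace α] {ν : Measure α} [SFinite ν] {a : α → X → F}
    (ha : MemLp (Function.uncurry a) 2 (ν.prod μ)) : ∀ᵐ t ∂ν, MemLp (a t) 2 μ := by
  have ha2 := (memLp_two_iff_integrable_sq_norm ha.1).1 ha
  filter_upwards [ha.1.prodMk_left, ha2.prod_right_ae] with t h1 h2
  exact (memLp_two_iff_integrable_sq_norm h1).2 h2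

omit [InnerProductSpace ℝ F] in
theorem ae_integrableOn_slice {a : ℝ → X → F}
    (ha : MemLp (Function.uncurry a) 2 ((volume.restrict (Ioo 0 T)).prod μ)) :
    ∀ᵐ x ∂μ, IntegrableOn (fun t => a t x) (Ioo 0 T) := by
  have ha2 := (memLp_two_iff_integrable_sq_norm ha.1).1 ha
  filter_upwards [ha.1.prod_swap.prodMk_left, ha2.prod_left_ae] with x h1 h2
  exact ((memLp_two_iff_integrable_sq_norm h1).2 h2).integrable one_le_two

theorem memLp_timeConvX {a : ℝ → ℝ} {v : ℝ → X → F} (ha : IntegrableOn a (Ioo 0 T))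
    (hv : MemLp (Function.uncurry v) 2 ((volume.restrict (Ioo 0 T)).prod μ)) :
    MemLp (Function.uncurry (timeConvX a v)) 2 ((volume.restrict (Ioo 0 T)).prod μ) := by
  refine ((isSchurKernel_convKernel ha).memLp_integral_smul hv).ae_eq ?_
  filter_upwards [ae_fst_mem_Ioo T μ] with q hq
  exact integral_convKernel_smul a (fun τ => v τ q.2) hq

theorem memLp_dualConvX {a : ℝ → ℝ} {v : ℝ → X → F} (ha : IntegrableOn a (Ioo 0 T))
    (hv : MemLp (Function.uncurry v) 2 ((volume.restrict (Ioo 0 T)).prod μ)) :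
    MemLp (Function.uncurry (dualConvX T a v)) 2 ((volume.restrict (Ioo 0 T)).prod μ) := by
  refine ((isSchurKernel_convKernel ha).swap.memLp_integral_smul hv).ae_eq ?_
  filter_upwards [ae_fst_mem_Ioo T μ] with q hq
  exact integral_convKernel_swap_smul a (fun τ => v τ q.2) hq

/-- Duality between the convolution and the dual convolution, first half: the bilinear form of
the kernel `l (τ - t)` in terms of `l * a`. -/
theorem integral_convKernel_inner_eq_timeConvX [CompleteSpace F] {l : ℝ → ℝ} {a b : ℝ → X → F}
    (hl : IntegrableOn l (Ioo 0 T))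
    (ha : MemLp (Function.uncurry a) 2 ((volume.restrict (Ioo 0 T)).prod μ))
    (hb : MemLp (Function.uncurry b) 2 ((volume.restrict (Ioo 0 T)).prod μ)) :
    ∫ p : (ℝ × ℝ) × X, convKernel T l p.1.1 p.1.2 * inner ℝ (a p.1.2 p.2) (b p.1.1 p.2)
        ∂(((volume.restrict (Ioo 0 T)).prod (volume.restrict (Ioo 0 T))).prod μ) =
      ∫ q : ℝ × X, inner ℝ (timeConvX l a q.1 q.2) (b q.1 q.2)
        ∂((volume.restrict (Ioo 0 T)).prod μ) := by
  rw [(isSchurKernel_convKernel hl).integral_mul_inner_left ha hb]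
  refine integral_congr_ae ?_
  filter_upwards [ae_fst_mem_Ioo T μ] with q hq
  rw [integral_convKernel_smul l (fun τ => a τ q.2) hq]
  rfl

/-- Duality between the convolution and the dual convolution, second half: the bilinear form of
the kernel `l (τ - t)` in terms of the dual convolution of `l` and `b`. -/
theorem integral_convKernel_inner_eq_dualConvX [CompleteSpace F] {l : ℝ → ℝ} {a b : ℝ → X → F}
    (hl : IntegrableOn l (Ioo 0 T))
    (ha : MemLp (Function.uncurry a) 2 ((volume.restrict (Ioo 0 T)).prod μ))
    (hb : MemLp (Function.uncurry b) 2 ((volume.restrict (Ioo 0 T)).prod μ)) :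
    ∫ p : (ℝ × ℝ) × X, convKernel T l p.1.1 p.1.2 * inner ℝ (a p.1.2 p.2) (b p.1.1 p.2)
        ∂(((volume.restrict (Ioo 0 T)).prod (volume.restrict (Ioo 0 T))).prod μ) =
      ∫ q : ℝ × X, inner ℝ (a q.1 q.2) (dualConvX T l b q.1 q.2)
        ∂((volume.restrict (Ioo 0 T)).prod μ) := by
  rw [(isSchurKernel_convKernel hl).integral_mul_inner_right ha hb]
  refine integral_congr_ae ?_
  filter_upwards [ae_fst_mem_Ioo T μ] with q hq
  rw [integral_convKernel_swap_smul l (fun τ => b τ q.2) hq]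
  rfl

/-- Testing at time `t` with the function at time `τ` and integrating against the nonnegative
kernel `l (τ - t)` amounts to testing with the dual convolution of `l` and the test function. -/
theorem integral_inner_dualConvX_le [CompleteSpace F] {l : ℝ → ℝ} {w d f : ℝ → X → ℝ}
    {G H : ℝ → X → F} (hl : IntegrableOn l (Ioo 0 T))
    (hl0 : ∀ᵐ t ∂volume.restrict (Ioi (0 : ℝ)), 0 ≤ l t)
    (hw : MemLp (Function.uncurry w) 2 ((volume.restrict (Ioo 0 T)).prod μ))
    (hd : MemLp (Function.uncurry d) 2 ((volume.restrict (Ioo 0 T)).prod μ))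
    (hf : MemLp (Function.uncurry f) 2 ((volume.restrict (Ioo 0 T)).prod μ))
    (hG : MemLp (Function.uncurry G) 2 ((volume.restrict (Ioo 0 T)).prod μ))
    (hH : MemLp (Function.uncurry H) 2 ((volume.restrict (Ioo 0 T)).prod μ))
    (hineq : ∀ᵐ τ ∂volume.restrict (Ioo 0 T), ∀ᵐ t ∂volume.restrict (Ioo 0 T),
      ∫ x, (w τ x * d t x + inner ℝ (H t x) (G τ x)) ∂μ ≤ ∫ x, f t x * w τ x ∂μ) :
    (∫ q : ℝ × X, w q.1 q.2 * timeConvX l d q.1 q.2 ∂((volume.restrict (Ioo 0 T)).prod μ)) +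
      ∫ q : ℝ × X, inner ℝ (H q.1 q.2) (dualConvX T l G q.1 q.2)
        ∂((volume.restrict (Ioo 0 T)).prod μ) ≤
      ∫ q : ℝ × X, f q.1 q.2 * dualConvX T l w q.1 q.2 ∂((volume.restrict (Ioo 0 T)).prod μ) := by
  set ν : Measure ℝ := volume.restrict (Ioo 0 T) with hν
  have hκ := isSchurKernel_convKernel hl
  have i1 := hκ.integrable_mul_inner hd hw
  have i2 := hκ.integrable_mul_inner hH hG
  have i3 := hκ.integrable_mul_inner hf hw
  have e1 := integral_convKernel_inner_eq_timeConvX hl hd hw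
  have e2 := integral_convKernel_inner_eq_dualConvX hl hH hG
  have e3 := integral_convKernel_inner_eq_dualConvX hl hf hw
  simp only [RCLike.inner_apply, conj_trivial] at e1 e3 i1 i3
  have e3' : ∫ q : ℝ × X, f q.1 q.2 * dualConvX T l w q.1 q.2 ∂(ν.prod μ) =
      ∫ q : ℝ × X, dualConvX T l w q.1 q.2 * f q.1 q.2 ∂(ν.prod μ) := by
    simp only [mul_comm]
  rw [e3', ← e1, ← e2, ← e3, ← sub_nonpos, ← integral_add i1 i2,
    ← integral_sub (Integrable.fun_add i1 i2) i3]
  have i := (Integrable.fun_add i1 i2).sub i3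
  refine (integral_prod _ i).trans_le ?_
  refine (integral_prod _ i.integral_prod_left).trans_le ?_
  refine integral_nonpos_of_ae ?_
  filter_upwards [hineq, ae_memLp_slice hw, ae_memLp_slice hG] with τ hτ hwτ hGτ
  refine integral_nonpos_of_ae ?_
  have hlτ : ∀ᵐ t ∂ν, 0 ≤ convKernel T l τ t := by
    rw [ae_restrict_iff' measurableSet_Ioi] at hl0
    refine ae_restrict_of_ae ?_
    filter_upwards [(quasiMeasurePreserving_sub_left_of_right_invariant volume τ).ae hl0] with t ht
    simp only [convKernel, indicator]
    split_ifs with hmem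
    exacts [ht hmem.1, le_rfl]
  filter_upwards [hτ, hlτ, ae_memLp_slice hd, ae_memLp_slice hH, ae_memLp_slice hf]
    with t ht hκt hdt hHt hft
  have j1 : Integrable (fun x => w τ x * d t x) μ := hwτ.integrable_mul hdt
  have j2 : Integrable (fun x => inner ℝ (H t x) (G τ x)) μ := hHt.integrable_inner hGτ
  have j3 : Integrable (fun x => f t x * w τ x) μ := hft.integrable_mul hwτ
  have e : ∫ x, (convKernel T l τ t * (w τ x * d t x) +
        convKernel T l τ t * inner ℝ (H t x) (G τ x) - convKernel T l τ t * (w τ x * f t x)) ∂μ =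
      convKernel T l τ t * ((∫ x, (w τ x * d t x + inner ℝ (H t x) (G τ x)) ∂μ) -
        ∫ x, f t x * w τ x ∂μ) := by
    rw [← integral_sub (Integrable.fun_add j1 j2) j3, ← integral_const_mul]
    congr 1
    ext x
    ring
  exact e.trans_le (mul_nonpos_of_nonneg_of_nonpos hκt (sub_nonpos.2 ht))

theorem integral_convKernel_left (a : ℝ → ℝ) {t : ℝ} (ht : t ∈ Ioo 0 T) :
    ∫ τ in Ioo 0 T, convKernel T a t τ = ∫ s in (0 : ℝ)..t, a s := by
  have h := integral_convKernel_smul a (fun _ => (1 : ℝ)) ht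
  rw [timeConv_comm, timeConv_one_left] at h
  simpa using h

theorem integral_convKernel_right (a : ℝ → ℝ) {t : ℝ} (ht : t ∈ Ioo 0 T) :
    ∫ τ in Ioo 0 T, convKernel T a τ t = ∫ s in (0 : ℝ)..(T - t), a s := by
  have h := integral_convKernel_swap_smul a (fun _ => (1 : ℝ)) ht
  rw [dualConv_eq_timeConv_reflect, timeConv_comm, timeConv_one_left] at h
  simpa using h

theorem integrable_primitive_mul {a : ℝ → ℝ} {Y : ℝ → X → ℝ} (ha : IntegrableOn a (Ioo 0 T))
    (hY : Integrable (Function.uncurry Y) ((volume.restrict (Ioo 0 T)).prod μ)) :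
    Integrable (fun q : ℝ × X => (∫ s in (0 : ℝ)..q.1, a s) * Y q.1 q.2)
      ((volume.restrict (Ioo 0 T)).prod μ) := by
  refine ((isSchurKernel_convKernel ha).integrable_integral_mul hY).congr ?_
  filter_upwards [ae_fst_mem_Ioo T μ] with q hq
  rw [integral_convKernel_left a hq]

theorem integrable_primitive_reflect_mul {a : ℝ → ℝ} {Y : ℝ → X → ℝ}
    (ha : IntegrableOn a (Ioo 0 T))
    (hY : Integrable (Function.uncurry Y) ((volume.restrict (Ioo 0 T)).prod μ)) :
    Integrable (fun q : ℝ × X => (∫ s in (0 : ℝ)..(T - q.1), a s) * Y q.1 q.2)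
      ((volume.restrict (Ioo 0 T)).prod μ) := by
  refine ((isSchurKernel_convKernel ha).swap.integrable_integral_mul hY).congr ?_
  filter_upwards [ae_fst_mem_Ioo T μ] with q hq
  rw [integral_convKernel_right a hq]

/-- Polarization for the convolution kernel: its integrals in either variable are primitives
of `h`. -/
theorem integral_convKernel_mul_norm_sub_sq [CompleteSpace F] {h : ℝ → ℝ} {g : ℝ → X → F}
    (hh : IntegrableOn h (Ioo 0 T))
    (hg : MemLp (Function.uncurry g) 2 ((volume.restrict (Ioo 0 T)).prod μ)) :
    ∫ p : (ℝ × ℝ) × X, convKernel T h p.1.1 p.1.2 * ‖g p.1.1 p.2 - g p.1.2 p.2‖ ^ 2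
        ∂(((volume.restrict (Ioo 0 T)).prod (volume.restrict (Ioo 0 T))).prod μ) =
      (∫ q : ℝ × X, (∫ s in (0 : ℝ)..q.1, h s) * ‖g q.1 q.2‖ ^ 2
        ∂((volume.restrict (Ioo 0 T)).prod μ)) +
      (∫ q : ℝ × X, (∫ s in (0 : ℝ)..(T - q.1), h s) * ‖g q.1 q.2‖ ^ 2
        ∂((volume.restrict (Ioo 0 T)).prod μ)) -
      2 * ∫ q : ℝ × X, inner ℝ (g q.1 q.2) (dualConvX T h g q.1 q.2)
        ∂((volume.restrict (Ioo 0 T)).prod μ) := by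
  rw [(isSchurKernel_convKernel hh).integral_mul_norm_sub_sq hg]
  congr 1
  · congr 1
    · refine integral_congr_ae ?_
      filter_upwards [ae_fst_mem_Ioo T μ] with q hq
      rw [integral_convKernel_left h hq]
    · refine integral_congr_ae ?_
      filter_upwards [ae_fst_mem_Ioo T μ] with q hq
      rw [integral_convKernel_right h hq]
  · congr 1
    refine integral_congr_ae ?_
    filter_upwards [ae_fst_mem_Ioo T μ] with q hq
    rw [integral_convKernel_swap_smul h (fun τ => g τ q.2) hq]
    rfl

section Resolvent

variable {γ : ℝ} {k l h : ℝ → ℝ}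

omit [SFinite μ] in
/-- The sum `k_γ(T - t) + k_γ(t)` in terms of primitives of `h_γ`. -/
theorem IsResolventKernel.ae_eq_primitive_reflect (hkl : IsPCPair k l)
    (hh : IsResolventKernel γ l h) :
    ∀ᵐ q : ℝ × X ∂((volume.restrict (Ioo 0 T)).prod μ),
      timeConv k h (T - q.1) + timeConv k h q.1 =
        2 * γ - γ * (∫ s in (0 : ℝ)..q.1, h s) - γ * ∫ s in (0 : ℝ)..(T - q.1), h s := by
  have h1 := ae_Ioo_of_Ioi (hh.timeConv_eq hkl) T
  have h2 := ae_sub_left_Ioo le_rfl h1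
  filter_upwards [Measure.quasiMeasurePreserving_fst.ae h1,
    Measure.quasiMeasurePreserving_fst.ae h2] with q e1 e2
  rw [e1, e2]
  ring

omit [InnerProductSpace ℝ F] in
theorem IsResolventKernel.integrable_energy (hkl : IsPCPair k l) (hh : IsResolventKernel γ l h)
    {g : ℝ → X → F} (hg : MemLp (Function.uncurry g) 2 ((volume.restrict (Ioo 0 T)).prod μ)) :
    Integrable (fun q : ℝ × X => (timeConv k h (T - q.1) + timeConv k h q.1) * ‖g q.1 q.2‖ ^ 2)
      ((volume.restrict (Ioo 0 T)).prod μ) := by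
  have hi := integrableOn_Ioo_of_locallyIntegrableOn hh.1 T
  have hg2 := (memLp_two_iff_integrable_sq_norm hg.1).1 hg
  refine (((hg2.const_mul (2 * γ)).sub
    ((integrable_primitive_mul (Y := fun t x => ‖g t x‖ ^ 2) hi hg2).const_mul γ)).sub
    ((integrable_primitive_reflect_mul (Y := fun t x => ‖g t x‖ ^ 2) hi hg2).const_mul γ)).congr ?_
  filter_upwards [hh.ae_eq_primitive_reflect hkl] with q hq
  simp only [Pi.sub_apply, hq, Function.uncurry]
  ring

/-- The quadratic identity for the dual convolution: for `g = l *ᵀ G`, the pairing of `h_γ *ᵀ G`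
with `g` is the energy with the kernels `k_γ` and `γ h_γ = -k_γ'`. -/
theorem IsResolventKernel.integral_inner_dualConvX [CompleteSpace F]
    (hkl : IsPCPair k l) (hh : IsResolventKernel γ l h)
    {G : ℝ → X → F} (hG : MemLp (Function.uncurry G) 2 ((volume.restrict (Ioo 0 T)).prod μ)) :
    ∫ q : ℝ × X, inner ℝ (dualConvX T h G q.1 q.2) (dualConvX T l G q.1 q.2)
        ∂((volume.restrict (Ioo 0 T)).prod μ) =
      1 / 2 * (∫ q : ℝ × X, (timeConv k h (T - q.1) + timeConv k h q.1) *
        ‖dualConvX T l G q.1 q.2‖ ^ 2 ∂((volume.restrict (Ioo 0 T)).prod μ)) +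
      1 / 2 * (γ * ∫ p : (ℝ × ℝ) × X, convKernel T h p.1.1 p.1.2 *
          ‖dualConvX T l G p.1.1 p.2 - dualConvX T l G p.1.2 p.2‖ ^ 2
        ∂(((volume.restrict (Ioo 0 T)).prod (volume.restrict (Ioo 0 T))).prod μ)) := by
  have hi := integrableOn_Ioo_of_locallyIntegrableOn hh.1 T
  have hl := integrableOn_Ioo_of_locallyIntegrableOn hkl.locallyIntegrable_l T
  have hg := memLp_dualConvX hl hG
  have hhg := memLp_dualConvX hi hg
  have hhG := memLp_dualConvX hi hG
  set g := dualConvX T l G with hgdef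
  have hg2 : Integrable (fun q : ℝ × X => ‖g q.1 q.2‖ ^ 2) ((volume.restrict (Ioo 0 T)).prod μ) := (memLp_two_iff_integrable_sq_norm hg.1).1 hg
  have i1 := integrable_primitive_mul (Y := fun t x => ‖g t x‖ ^ 2) hi hg2
  have i2 := integrable_primitive_reflect_mul (Y := fun t x => ‖g t x‖ ^ 2) hi hg2
  have i3 : Integrable (fun q : ℝ × X => inner ℝ (g q.1 q.2) (dualConvX T h g q.1 q.2)) _ :=
    hg.integrable_inner hhg
  rw [integral_convKernel_mul_norm_sub_sq hi hg]
  have i0 : Integrable (fun q : ℝ × X => 2 * γ * ‖g q.1 q.2‖ ^ 2 -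
      γ * ((∫ s in (0 : ℝ)..q.1, h s) * ‖g q.1 q.2‖ ^ 2)) ((volume.restrict (Ioo 0 T)).prod μ) :=
    (hg2.const_mul (2 * γ)).sub (i1.const_mul γ)
  have e1 : ∫ q : ℝ × X, (timeConv k h (T - q.1) + timeConv k h q.1) * ‖g q.1 q.2‖ ^ 2
        ∂((volume.restrict (Ioo 0 T)).prod μ) =
      2 * γ * (∫ q : ℝ × X, ‖g q.1 q.2‖ ^ 2 ∂((volume.restrict (Ioo 0 T)).prod μ)) -
      γ * (∫ q : ℝ × X, (∫ s in (0 : ℝ)..q.1, h s) * ‖g q.1 q.2‖ ^ 2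
        ∂((volume.restrict (Ioo 0 T)).prod μ)) -
      γ * ∫ q : ℝ × X, (∫ s in (0 : ℝ)..(T - q.1), h s) * ‖g q.1 q.2‖ ^ 2
        ∂((volume.restrict (Ioo 0 T)).prod μ) := by
    rw [← integral_const_mul, ← integral_const_mul, ← integral_const_mul,
      ← integral_sub (hg2.const_mul (2 * γ)) (i1.const_mul γ),
      ← integral_sub i0 (i2.const_mul γ)]
    refine integral_congr_ae ?_
    filter_upwards [hh.ae_eq_primitive_reflect hkl] with q hq
    rw [hq]
    ring
  have hae : Function.uncurry (dualConvX T h G) =ᵐ[(volume.restrict (Ioo 0 T)).prod μ]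
      Function.uncurry fun t x => γ • g t x - γ • dualConvX T h g t x := by
    refine ae_prod_eq_of_slices hhG.1 ((hg.const_smul γ).sub (hhg.const_smul γ)).1 ?_
    filter_upwards [ae_integrableOn_slice hG] with x hx
    exact hh.dualConv_eq_sub hkl.locallyIntegrable_l hx
  have e2 : ∫ q : ℝ × X, inner ℝ (dualConvX T h G q.1 q.2) (g q.1 q.2)
        ∂((volume.restrict (Ioo 0 T)).prod μ) =
      γ * (∫ q : ℝ × X, ‖g q.1 q.2‖ ^ 2 ∂((volume.restrict (Ioo 0 T)).prod μ)) -
      γ * ∫ q : ℝ × X, inner ℝ (g q.1 q.2) (dualConvX T h g q.1 q.2)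
        ∂((volume.restrict (Ioo 0 T)).prod μ) := by
    rw [← integral_const_mul, ← integral_const_mul,
      ← integral_sub (hg2.const_mul γ) (i3.const_mul γ)]
    refine integral_congr_ae ?_
    filter_upwards [hae] with q hq
    simp only [Function.uncurry] at hq
    rw [hq, inner_sub_left, inner_smul_left, inner_smul_left, real_inner_self_eq_norm_sq,
      real_inner_comm]
    simp
  rw [e1, e2]
  ring

end Resolvent

end Cylinder

/-! ### The duality inequality -/

section DualityInequality

variable {N : ℕ} {T : ℝ} {Ω : Set (EuclideanSpace ℝ (Fin N))}

theorem timeConv_const_right (h : ℝ → ℝ) (c t : ℝ) :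
    timeConv h (fun _ => c) t = c * timeConv (fun _ => 1) h t := by
  rw [timeConv_comm (fun _ => 1) h, timeConv, timeConv, ← intervalIntegral.integral_const_mul]
  simp only [smul_eq_mul, mul_one, mul_comm]

theorem integral_integral_eq_integral_cylinder {F : ℝ → EuclideanSpace ℝ (Fin N) → ℝ} (hT : 0 ≤ T)
    (hF : Integrable (Function.uncurry F) ((volume.restrict (Ioo 0 T)).prod (volume.restrict Ω))) :
    ∫ t in (0 : ℝ)..T, ∫ x in Ω, F t x =
      ∫ q : ℝ × EuclideanSpace ℝ (Fin N), F q.1 q.2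
        ∂((volume.restrict (Ioo 0 T)).prod (volume.restrict Ω)) := by
  rw [intervalIntegral.integral_of_le hT, integral_Ioc_eq_integral_Ioo]
  exact (integral_prod _ hF).symm

/-- The iterated integral over `0 < s < t < T` in terms of the kernel `h (t - τ)`, by the
substitution `τ = t - s`. -/
theorem integral_increment_eq_integral_convKernel {h d : ℝ → ℝ} {γ : ℝ}
    {g : ℝ → EuclideanSpace ℝ (Fin N) → EuclideanSpace ℝ (Fin N)} (hT : 0 ≤ T)
    (hh : IntegrableOn h (Ioo 0 T)) (hd : ∀ᵐ s ∂volume.restrict (Ioi 0), d s = γ * h s)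
    (hg : MemLp (Function.uncurry g) 2 ((volume.restrict (Ioo 0 T)).prod (volume.restrict Ω))) :
    ∫ t in (0 : ℝ)..T, ∫ s in (0 : ℝ)..t, ∫ x in Ω, d s * ‖g t x - g (t - s) x‖ ^ 2 =
      γ * ∫ p : (ℝ × ℝ) × EuclideanSpace ℝ (Fin N),
          convKernel T h p.1.1 p.1.2 * ‖g p.1.1 p.2 - g p.1.2 p.2‖ ^ 2
        ∂(((volume.restrict (Ioo 0 T)).prod (volume.restrict (Ioo 0 T))).prod
          (volume.restrict Ω)) := by
  have hi := (isSchurKernel_convKernel hh).integrable_mul_norm_sub_sq hg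
  have e : ∫ p : (ℝ × ℝ) × EuclideanSpace ℝ (Fin N),
          convKernel T h p.1.1 p.1.2 * ‖g p.1.1 p.2 - g p.1.2 p.2‖ ^ 2
        ∂(((volume.restrict (Ioo 0 T)).prod (volume.restrict (Ioo 0 T))).prod
          (volume.restrict Ω)) =
      ∫ t in Ioo 0 T, ∫ τ in Ioo 0 T, ∫ x in Ω, convKernel T h t τ * ‖g t x - g τ x‖ ^ 2 :=
    (integral_prod _ hi).trans (integral_prod _ hi.integral_prod_left)
  rw [e, ← integral_const_mul, intervalIntegral.integral_of_le hT, integral_Ioc_eq_integral_Ioo]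
  refine setIntegral_congr_fun measurableSet_Ioo fun t ht => ?_
  simp only [integral_const_mul]
  have e1 := integral_convKernel_smul h (fun τ => ∫ x in Ω, ‖g t x - g τ x‖ ^ 2) ht
  simp only [smul_eq_mul] at e1
  rw [e1, timeConv, ← intervalIntegral.integral_const_mul]
  have e2 := intervalIntegral.integral_comp_sub_left
    (fun τ => γ * (h (t - τ) * ∫ x in Ω, ‖g t x - g τ x‖ ^ 2)) t (a := 0) (b := t)
  simp only [sub_self, sub_zero, sub_sub_cancel] at e2
  simp only [smul_eq_mul, ← e2]
  refine intervalIntegral.integral_congr_ae ?_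
  rw [ae_restrict_iff' measurableSet_Ioi] at hd
  filter_upwards [hd] with s hs hst
  rw [uIoc_of_le ht.1.le] at hst
  rw [hs hst.1, mul_assoc]

/-- The map `(t, s, x) ↦ (t, t - s, x)` preserves the volume. -/
theorem measurePreserving_shear (N : ℕ) :
    MeasurePreserving (fun p : ℝ × ℝ × EuclideanSpace ℝ (Fin N) => (p.1, p.1 - p.2.1, p.2.2)) := by
  refine MeasurePreserving.skew_product (g := fun t (q : ℝ × EuclideanSpace ℝ (Fin N)) =>
    (t - q.1, q.2)) (MeasurePreserving.id volume) ?_ (Filter.Eventually.of_forall fun t => ?_)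
  · exact (measurable_fst.sub (measurable_fst.comp measurable_snd)).prodMk
      (measurable_snd.comp measurable_snd)
  · exact ((Measure.measurePreserving_sub_left volume t).prod (MeasurePreserving.id volume)).map_eq

/-- Absolute convergence of the triple integral over `0 < s < t < T`, transported from the
variables `(t, τ)` by the shear `τ = t - s`. -/
theorem integrableOn_increment {h d : ℝ → ℝ} {γ : ℝ}
    {g : ℝ → EuclideanSpace ℝ (Fin N) → EuclideanSpace ℝ (Fin N)} (hΩ : MeasurableSet Ω)
    (hh : IntegrableOn h (Ioo 0 T)) (hd : ∀ᵐ s ∂volume.restrict (Ioi 0), d s = γ * h s)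
    (hg : MemLp (Function.uncurry g) 2 ((volume.restrict (Ioo 0 T)).prod (volume.restrict Ω))) :
    IntegrableOn (fun p : ℝ × ℝ × EuclideanSpace ℝ (Fin N) =>
        d p.2.1 * ‖g p.1 p.2.2 - g (p.1 - p.2.1) p.2.2‖ ^ 2)
      {p | 0 < p.2.1 ∧ p.2.1 < p.1 ∧ p.1 < T ∧ p.2.2 ∈ Ω} := by
  have hi := (isSchurKernel_convKernel hh).integrable_mul_norm_sub_sq hg
  have h1 := (measurePreserving_prodAssoc (volume.restrict (Ioo 0 T)) (volume.restrict (Ioo 0 T))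
    (volume.restrict Ω)).symm.integrable_comp_of_integrable hi
  rw [Measure.prod_restrict, Measure.prod_restrict, ← Measure.volume_eq_prod,
    ← Measure.volume_eq_prod] at h1
  have hB : MeasurableSet (Ioo 0 T ×ˢ Ioo 0 T ×ˢ Ω) :=
    measurableSet_Ioo.prod (measurableSet_Ioo.prod hΩ)
  have h2 := ((measurePreserving_shear N).integrable_comp_of_integrable
    ((integrable_indicator_iff hB).2 h1)).const_mul γ
  have hS : MeasurableSet {p : ℝ × ℝ × EuclideanSpace ℝ (Fin N) |
      0 < p.2.1 ∧ p.2.1 < p.1 ∧ p.1 < T ∧ p.2.2 ∈ Ω} := by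
    refine (measurableSet_lt measurable_const (measurable_fst.comp measurable_snd)).inter
      ((measurableSet_lt (measurable_fst.comp measurable_snd) measurable_fst).inter
      ((measurableSet_lt measurable_fst measurable_const).inter ?_))
    exact (measurable_snd.comp measurable_snd) hΩ
  refine (h2.integrableOn (s := {p : ℝ × ℝ × EuclideanSpace ℝ (Fin N) |
      0 < p.2.1 ∧ p.2.1 < p.1 ∧ p.1 < T ∧ p.2.2 ∈ Ω})).congr_fun_ae ?_
  rw [ae_restrict_iff' measurableSet_Ioi] at hd
  have hd' : ∀ᵐ p : ℝ × ℝ × EuclideanSpace ℝ (Fin N), p.2.1 ∈ Ioi (0 : ℝ) →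
      d p.2.1 = γ * h p.2.1 :=
    (Measure.quasiMeasurePreserving_fst.comp Measure.quasiMeasurePreserving_snd).ae hd
  rw [Filter.EventuallyEq, ae_restrict_iff' hS]
  filter_upwards [hd'] with p hp hpS
  obtain ⟨a1, a2, a3, a4⟩ := hpS
  have hm : (p.1, p.1 - p.2.1, p.2.2) ∈ Ioo 0 T ×ˢ Ioo 0 T ×ˢ Ω :=
    ⟨⟨by linarith, a3⟩, ⟨by simpa using a2, by simp only; linarith⟩, a4⟩
  have hm' : p.2.1 ∈ Ioo 0 T := ⟨a1, a2.trans a3⟩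
  rw [hp a1, Function.comp_apply, indicator_of_mem hm]
  simp only [MeasurableEquiv.prodAssoc, MeasurableEquiv.symm_mk, MeasurableEquiv.coe_mk,
    Function.comp_apply, Equiv.prodAssoc_symm_apply, convKernel, indicator_of_mem hm',
    sub_sub_cancel, mul_assoc]

/-- The weak time derivative of `k_γ * v` is `γ v - γ (h_γ * v)`, for `v` in `L²` of the cylinder. -/
theorem hasWeakDerivOn_timeConvX {k l h : ℝ → ℝ} {γ : ℝ} (hkl : IsPCPair k l)
    (hh : IsResolventKernel γ l h) (hT : 0 ≤ T) [IsFiniteMeasure (volume.restrict Ω)]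
    {v : ℝ → EuclideanSpace ℝ (Fin N) → ℝ}
    (hv : MemLp (Function.uncurry v) 2 ((volume.restrict (Ioo 0 T)).prod (volume.restrict Ω))) :
    HasWeakDerivOn (Ioo 0 T ×ˢ Ω) ((1 : ℝ), (0 : EuclideanSpace ℝ (Fin N)))
      (Function.uncurry (timeConvX (timeConv k h) v))
      (Function.uncurry fun t x => γ * v t x - γ * timeConvX h v t x) := by
  have hk := integrableOn_Ioo_of_locallyIntegrableOn hkl.locallyIntegrable_k T
  have hi := integrableOn_Ioo_of_locallyIntegrableOn hh.1 T
  refine hasWeakDerivOn_cylinder hT ((memLp_timeConvX (integrableOn_timeConv hk hi) hv).integrable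
    one_le_two) ?_ ?_
  · exact ((hv.const_mul γ).sub ((memLp_timeConvX hi hv).const_mul γ)).integrable one_le_two
  · filter_upwards [ae_integrableOn_slice hv] with x hx
    exact hh.timeConv_timeConv_eq_integral hkl hx

/-- `l * ∂ₜ(k_γ * [u - u₀]) = h_γ * u - u₀ (1 * h_γ)`. -/
theorem timeConvX_weakDeriv_ae_eq {k l h : ℝ → ℝ} {γ : ℝ} (hkl : IsPCPair k l)
    (hh : IsResolventKernel γ l h) [IsFiniteMeasure (volume.restrict Ω)]
    {u : ℝ → EuclideanSpace ℝ (Fin N) → ℝ} {u₀ : EuclideanSpace ℝ (Fin N) → ℝ}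
    (hu : MemLp (Function.uncurry u) 2 ((volume.restrict (Ioo 0 T)).prod (volume.restrict Ω)))
    (hu₀ : MemLp u₀ 2 (volume.restrict Ω)) :
    Function.uncurry (timeConvX l fun t x => γ * (u t x - u₀ x) -
        γ * timeConvX h (fun τ x => u τ x - u₀ x) t x)
      =ᵐ[(volume.restrict (Ioo 0 T)).prod (volume.restrict Ω)]
      Function.uncurry fun t x => timeConvX h u t x - timeConvX h (fun _ => u₀) t x := by
  have hl := integrableOn_Ioo_of_locallyIntegrableOn hkl.locallyIntegrable_l T
  have hi := integrableOn_Ioo_of_locallyIntegrableOn hh.1 T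
  have hu₀' : MemLp (Function.uncurry fun (_ : ℝ) x => u₀ x) 2
    ((volume.restrict (Ioo 0 T)).prod (volume.restrict Ω)) := hu₀.comp_snd _
  have hv : MemLp (Function.uncurry fun t x => u t x - u₀ x) 2
    ((volume.restrict (Ioo 0 T)).prod (volume.restrict Ω)) := hu.sub hu₀'
  refine ae_prod_eq_of_slices
    (memLp_timeConvX hl ((hv.const_mul γ).sub ((memLp_timeConvX hi hv).const_mul γ))).1
    ((memLp_timeConvX hi hu).sub (memLp_timeConvX hi hu₀')).1 ?_
  filter_upwards [ae_integrableOn_slice hu, ae_integrableOn_slice hu₀'] with x h1 h2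
  filter_upwards [hh.timeConv_sub_eq hkl.locallyIntegrable_l (h1.sub h2),
    timeConv_smul_sub_smul_right hi h1 h2 1 1] with t e1 e2
  simp only [one_smul] at e2
  exact e1.trans e2

end DualityInequality

theorem mainTheorem4 {N : ℕ} {Ω : Set (EuclideanSpace ℝ (Fin N))}
    (hΩo : IsOpen Ω) (hΩb : Bornology.IsBounded Ω) (hΩc : IsConnected Ω)
    {T : ℝ} (hT : 0 < T) {k l : ℝ → ℝ} (hkl : IsPCPair k l)
    (u₀ : EuclideanSpace ℝ (Fin N) → ℝ) (hu₀ : MemLp u₀ 2 (volume.restrict Ω))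
    (f u w : ℝ → EuclideanSpace ℝ (Fin N) → ℝ)
    (gw : ℝ → EuclideanSpace ℝ (Fin N) → EuclideanSpace ℝ (Fin N))
    (hf : IsL2Cyl T Ω f) (hu : IsL2Cyl T Ω u) (hku : ConvContinuousVanishing T Ω k u)
    (hw : ∀ᵐ p ∂volume.restrict (Ioo 0 T ×ˢ Ω), 0 ≤ w p.1 p.2)
    (hDN :
      (IsL2V T Ω (IsH10 Ω) w gw ∧
        ∀ n : ℕ, 1 ≤ n → RegularizedWeakIneq T Ω (IsH10 Ω) n k l u₀ f u gw) ∨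
      (IsL2V T Ω (IsH1 Ω) w gw ∧
        ∀ n : ℕ, 1 ≤ n → RegularizedWeakIneq T Ω (IsH1 Ω) n k l u₀ f u gw)) :
    ∀ n : ℕ, 1 ≤ n →
      -- the weak derivative of `k_n = regKernel n k l` exists, and is locally integrable up to `0`
      (∃ dkn : ℝ → ℝ, LocallyIntegrableOn dkn (Ici 0) ∧ HasWeakDerivOn (Ioi 0) 1 (regKernel n k l) dkn) ∧
      ∀ dkn : ℝ → ℝ, HasWeakDerivOn (Ioi 0) 1 (regKernel n k l) dkn →
        -- the integrand of the triple integral is nonnegative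
        (∀ᵐ s ∂volume.restrict (Ioi 0), 0 ≤ -dkn s) ∧
        -- all the integrals converge
        IntegrableOn (fun p : ℝ × EuclideanSpace ℝ (Fin N) =>
          w p.1 p.2 * timeConvX (resolventKernel n l) u p.1 p.2) (Ioo 0 T ×ˢ Ω) ∧
        IntegrableOn (fun p : ℝ × EuclideanSpace ℝ (Fin N) =>
          (regKernel n k l (T - p.1) + regKernel n k l p.1) * ‖dualConvX T l gw p.1 p.2‖ ^ 2) (Ioo 0 T ×ˢ Ω) ∧
        IntegrableOn (fun p : ℝ × ℝ × EuclideanSpace ℝ (Fin N) =>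
          -dkn p.2.1 * ‖dualConvX T l gw p.1 p.2.2 - dualConvX T l gw (p.1 - p.2.1) p.2.2‖ ^ 2)
          {p | 0 < p.2.1 ∧ p.2.1 < p.1 ∧ p.1 < T ∧ p.2.2 ∈ Ω} ∧
        IntegrableOn (fun p : ℝ × EuclideanSpace ℝ (Fin N) =>
          w p.1 p.2 * u₀ p.2 * timeConv (fun _ => 1) (resolventKernel n l) p.1) (Ioo 0 T ×ˢ Ω) ∧
        IntegrableOn (fun p : ℝ × EuclideanSpace ℝ (Fin N) =>
          timeConvX (resolventKernel n l) f p.1 p.2 * dualConvX T l w p.1 p.2)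
          (Ioo 0 T ×ˢ Ω) ∧
        IntegrableOn (fun p : ℝ × EuclideanSpace ℝ (Fin N) =>
          inner ℝ (dualConvX T (resolventKernel n l) gw p.1 p.2 - timeConvX (resolventKernel n l) gw p.1 p.2)
            (dualConvX T l gw p.1 p.2)) (Ioo 0 T ×ˢ Ω) ∧
        -- the duality inequality
        (∫ t in (0 : ℝ)..T, ∫ x in Ω, w t x * timeConvX (resolventKernel n l) u t x)
            + 1 / 2 * (∫ t in (0 : ℝ)..T, ∫ x in Ω, (regKernel n k l (T - t) + regKernel n k l t) * ‖dualConvX T l gw t x‖ ^ 2)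
            + 1 / 2 * (∫ t in (0 : ℝ)..T, ∫ s in (0 : ℝ)..t, ∫ x in Ω,
                -dkn s * ‖dualConvX T l gw t x - dualConvX T l gw (t - s) x‖ ^ 2)
          ≤ (∫ t in (0 : ℝ)..T, ∫ x in Ω, w t x * u₀ x * timeConv (fun _ => 1) (resolventKernel n l) t)
            + (∫ t in (0 : ℝ)..T, ∫ x in Ω,
                timeConvX (resolventKernel n l) f t x * dualConvX T l w t x)
            + (∫ t in (0 : ℝ)..T, ∫ x in Ω,
                inner ℝ (dualConvX T (resolventKernel n l) gw t x - timeConvX (resolventKernel n l) gw t x)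
                  (dualConvX T l gw t x)) := by

  have : IsFiniteMeasure (volume.restrict Ω) :=
    isFiniteMeasure_restrict.2 hΩb.measure_lt_top.ne
  obtain ⟨V, ⟨hwL, hgwL, hV⟩, hineq⟩ : ∃ V, IsL2V T Ω V w gw ∧
      ∀ n : ℕ, 1 ≤ n → RegularizedWeakIneq T Ω V n k l u₀ f u gw :=
    hDN.elim (fun h => ⟨_, h⟩) fun h => ⟨_, h⟩
  intro n hn
  have hγ : (0 : ℝ) < n := by exact_mod_cast hn
  have hh : IsResolventKernel n l (resolventKernel n l) :=
    isResolventKernel_resolventKernel n hkl.locallyIntegrable_l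
  have hwd := hh.hasWeakDerivOn hkl
  have hi := integrableOn_Ioo_of_locallyIntegrableOn hh.1 T
  have hl := integrableOn_Ioo_of_locallyIntegrableOn hkl.locallyIntegrable_l T
  have hnn := hh.nonneg hkl hγ
  have hkreg : regKernel n k l = timeConv k (resolventKernel n l) := rfl
  rw [hkreg]
  have hspec := hineq n hn
  rw [RegularizedWeakIneq, hkreg] at hspec
  set h := resolventKernel n l
  refine ⟨⟨fun s => -n * h s, hh.1.smul (-n : ℝ), hwd⟩, fun dkn hdkn => ?_⟩
  have hdh : ∀ᵐ s ∂volume.restrict (Ioi 0), -dkn s = n * h s := by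
    filter_upwards [hdkn.ae_eq isOpen_Ioi hwd] with s hs
    rw [hs]
    ring
  rw [IsL2Cyl, volume_restrict_cylinder] at hwL hgwL hf hu
  rw [volume_restrict_cylinder] at hw
  have hu₀' : MemLp (Function.uncurry fun (_ : ℝ) x => u₀ x) 2
    ((volume.restrict (Ioo 0 T)).prod (volume.restrict Ω)) := hu₀.comp_snd _
  have hv : MemLp (Function.uncurry fun t x => u t x - u₀ x) 2
    ((volume.restrict (Ioo 0 T)).prod (volume.restrict Ω)) := hu.sub hu₀'
  have hhu := memLp_timeConvX hi hu
  have hhu₀ := memLp_timeConvX hi hu₀'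
  have hhv := memLp_timeConvX hi hv
  have hhf := memLp_timeConvX hi hf
  have hhgw := memLp_timeConvX hi hgwL
  have hhgw' := memLp_dualConvX hi hgwL
  have hlw := memLp_dualConvX hl hwL
  have hlgw := memLp_dualConvX hl hgwL
  have hdv : MemLp (Function.uncurry fun t x => n * (u t x - u₀ x) -
      n * timeConvX h (fun τ x => u τ x - u₀ x) t x) 2
      ((volume.restrict (Ioo 0 T)).prod (volume.restrict Ω)) :=
    (hv.const_mul (n : ℝ)).sub (hhv.const_mul (n : ℝ))
  have I1 : Integrable (fun q : ℝ × EuclideanSpace ℝ (Fin N) =>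
      w q.1 q.2 * timeConvX h u q.1 q.2) _ := hwL.integrable_mul hhu
  have I2 := hh.integrable_energy hkl hlgw
  have I3 := integrableOn_increment hΩo.measurableSet hi hdh hlgw
  have I4' : Integrable (fun q : ℝ × EuclideanSpace ℝ (Fin N) =>
      w q.1 q.2 * timeConvX h (fun _ => u₀) q.1 q.2) _ := hwL.integrable_mul hhu₀
  have e4 : ∀ t x, w t x * timeConvX h (fun _ => u₀) t x =
      w t x * u₀ x * timeConv (fun _ => 1) h t := fun t x => by
    rw [timeConvX, timeConv_const_right, mul_assoc]
  have I4 := I4'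
  simp only [e4] at I4
  have I5 : Integrable (fun q : ℝ × EuclideanSpace ℝ (Fin N) =>
      timeConvX h f q.1 q.2 * dualConvX T l w q.1 q.2) _ := hhf.integrable_mul hlw
  have I6 : Integrable (fun q : ℝ × EuclideanSpace ℝ (Fin N) =>
      inner ℝ (dualConvX T h gw q.1 q.2 - timeConvX h gw q.1 q.2) (dualConvX T l gw q.1 q.2)) _ :=
    (hhgw'.sub hhgw).integrable_inner hlgw
  have I7 : Integrable (fun q : ℝ × EuclideanSpace ℝ (Fin N) =>
      inner ℝ (dualConvX T h gw q.1 q.2) (dualConvX T l gw q.1 q.2)) _ :=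
    hhgw'.integrable_inner hlgw
  refine ⟨?_, ?_, ?_, I3, ?_, ?_, ?_, ?_⟩
  · filter_upwards [hdh, hnn] with s e hs
    rw [e]
    positivity
  · rwa [IntegrableOn, volume_restrict_cylinder]
  · rwa [IntegrableOn, volume_restrict_cylinder]
  · rwa [IntegrableOn, volume_restrict_cylinder]
  · rwa [IntegrableOn, volume_restrict_cylinder]
  · rwa [IntegrableOn, volume_restrict_cylinder]
  -- For almost every `τ`, the weak inequality may be tested with `w τ ∈ V`.
  have htest : ∀ᵐ τ ∂volume.restrict (Ioo 0 T), ∀ᵐ t ∂volume.restrict (Ioo 0 T),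
      ∫ x in Ω, (w τ x * (n * (u t x - u₀ x) -
          n * timeConvX h (fun τ x => u τ x - u₀ x) t x) +
          inner ℝ (timeConvX h gw t x) (gw τ x)) ≤
        ∫ x in Ω, timeConvX h f t x * w τ x := by
    filter_upwards [hV, Measure.ae_ae_of_ae_prod hw] with τ h1 h2
    exact hspec _ (hasWeakDerivOn_timeConvX hkl hh hT.le hv) _ _ h1 h2
  have hmain := integral_inner_dualConvX_le hl hkl.nonneg_l hwL hdv hhf hgwL hhgw htest
  have E1 : ∫ q : ℝ × EuclideanSpace ℝ (Fin N), w q.1 q.2 *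
        timeConvX l (fun t x => n * (u t x - u₀ x) -
          n * timeConvX h (fun τ x => u τ x - u₀ x) t x) q.1 q.2
        ∂((volume.restrict (Ioo 0 T)).prod (volume.restrict Ω)) =
      (∫ q : ℝ × EuclideanSpace ℝ (Fin N), w q.1 q.2 * timeConvX h u q.1 q.2
        ∂((volume.restrict (Ioo 0 T)).prod (volume.restrict Ω))) -
      ∫ q : ℝ × EuclideanSpace ℝ (Fin N), w q.1 q.2 * u₀ q.2 * timeConv (fun _ => 1) h q.1
        ∂((volume.restrict (Ioo 0 T)).prod (volume.restrict Ω)) := by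
    rw [← integral_sub I1 I4]
    refine integral_congr_ae ?_
    filter_upwards [timeConvX_weakDeriv_ae_eq hkl hh hu hu₀] with q hq
    simp only [Function.uncurry] at hq
    rw [hq, mul_sub, e4]
  have E2 : ∫ q : ℝ × EuclideanSpace ℝ (Fin N),
        inner ℝ (timeConvX h gw q.1 q.2) (dualConvX T l gw q.1 q.2)
        ∂((volume.restrict (Ioo 0 T)).prod (volume.restrict Ω)) =
      (∫ q : ℝ × EuclideanSpace ℝ (Fin N),
        inner ℝ (dualConvX T h gw q.1 q.2) (dualConvX T l gw q.1 q.2)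
        ∂((volume.restrict (Ioo 0 T)).prod (volume.restrict Ω))) -
      ∫ q : ℝ × EuclideanSpace ℝ (Fin N),
        inner ℝ (dualConvX T h gw q.1 q.2 - timeConvX h gw q.1 q.2) (dualConvX T l gw q.1 q.2)
        ∂((volume.restrict (Ioo 0 T)).prod (volume.restrict Ω)) := by
    rw [← integral_sub I7 I6]
    congr 1
    ext q
    rw [inner_sub_left, sub_sub_cancel]
  rw [E1, E2, hh.integral_inner_dualConvX hkl hgwL,
    ← integral_increment_eq_integral_convKernel hT.le hi hdh hlgw] at hmain
  rw [integral_integral_eq_integral_cylinder hT.le I1,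
    integral_integral_eq_integral_cylinder hT.le I2,
    integral_integral_eq_integral_cylinder hT.le I4,
    integral_integral_eq_integral_cylinder hT.le I5,
    integral_integral_eq_integral_cylinder hT.le I6]
  linarith
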